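/- Let $d\in\mathbb N$ and let $F:\mathbb R^d\to\mathbb R$ be $\mathbb Z^d$-periodic of class $C^3$, with $\operatorname{argmin} F=\mathbb Z^d$, $F(0)=0$ and $D^2F(0)$ positive definite. Put $h(y,x)=\tfrac12|x-y|^2+F(y)$. Let $\psi:\mathbb R^d\to\mathbb R$ be the stationary solution of the inviscid equation, i.e. $\psi$ is continuous and $\mathbb Z^d$-periodic, $\psi(0)=0$, and $\psi(x)=\min_{y\in\mathbb R^d}h_\psi(y,x)$ for all $x$, where $h_\psi(y,x)=\psi(y)+h(y,x)$. Let $\Phi(x,p)=(x+p+\nabla F(x),\,p+\nabla F(x))$ be the twist map (a bijection of $\mathbb R^d\times\mathbb R^d$), $\pi_1(x,p)=x$, $\mathcal G_\psi=\{(x,\nabla\psi(x)): \psi\text{ differentiable at }x\}$ and $\mathcal D^-(\psi)=\pi_1\Phi^{-1}(\overline{\mathcal G_\psi})$. Call an open set $U\supset\mathcal D^-(\psi)$ admissible if $\psi$ is $C^3$ on $U$ with uniformly bounded second derivatives there, and there is $\delta>0$ such that $$h_\psi(y,x)-h_\psi(\bar y,x)\ge\delta|y-\bar y|^2\quad\text{for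 all }x\in U,\ \bar y\in\operatorname{argmin}h_\psi(\cdot,x),\ y\in\mathbb R^d,$$ $$h_\psi(y,x)-\min h_\psi(\cdot,x)\ge\delta\quad\text{for all }x\in\mathbb R^d,\ y\notin U.$$ For $n\in\mathbb N$, $X=(x_{-n},\dots,x_{-1})\in(\mathbb R^d)^n=\mathbb R^{nd}$ and $x_0=x$, put $$H_{n,x}(X)=\sum_{i=-n}^{-1}h(x_i,x_{i+1})+\psi(x_{-n})-\psi(x),$$ and, where $\psi$ is differentiable at $x$, $X^*(x)=(x^*_{-n},\dots,x^*_{-1})$ with $x^*_{-k}=\pi_1\Phi^{-k}(x,\nabla\psi(x))$. Then admissible sets exist, and for every admissible $U$ there is a constant $C>1$ such that for all $n\in\mathbb N$ and all $x\in U$: $H_{n,x}$ attains its global minimum at $X^*(x)$, it is of class $C^2$ near $X^*(x)$, and its Hessian $\mathcal A^*_{n,x}=D^2H_{n,x}(X^*(x))$ satisfies $$\mathcal A^*_{n,x}\ \ge\ C^{-1}I_{nd}.$$ -/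

import Mathlib

open Set

noncomputable section

namespace KickedHJ

/-- The Euclidean space `ℝ^d`. -/
abbrev E (d : ℕ) : Type := EuclideanSpace ℝ (Fin d)

/-- The integer vector `k ∈ ℤ^d`, seen as a point of `ℝ^d`. -/
def latticeVec {d : ℕ} (k : Fin d → ℤ) : E d := WithLp.toLp 2 (fun i => (k i : ℝ))

/-- `ℤ^d`-periodic functions on `ℝ^d`. -/
def IsPeriodic {d : ℕ} (f : E d → ℝ) : Prop :=
  ∀ (k : Fin d → ℤ) (x : E d), f (x + latticeVec k) = f x

/-- The second derivative `D² f (x)`, as a bilinear form. -/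
def secondDeriv {V : Type*} [NormedAddCommGroup V] [NormedSpace ℝ V] (f : V → ℝ) (x : V) :
    V →L[ℝ] V →L[ℝ] ℝ :=
  fderiv ℝ (fderiv ℝ f) x

/-- The standing assumption on the kick potential: `F` is periodic of class `C³`, its minimum is
attained on the torus exactly at `0`, `F 0 = 0`, and `D² F (0)` is positive definite. -/
structure IsKickPotential {d : ℕ} (F : E d → ℝ) : Prop where
  contDiff : ContDiff ℝ 3 F
  periodic : IsPeriodic F
  argmin_eq : {x : E d | ∀ y, F x ≤ F y} = range (latticeVec (d := d))
  map_zero : F 0 = 0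
  posDef : ∀ v : E d, v ≠ 0 → 0 < secondDeriv F 0 v v

/-- The generating function `h(y, x) = |x - y|² / 2 + F(y)`. -/
def genFun {d : ℕ} (F : E d → ℝ) (y x : E d) : ℝ := ‖x - y‖ ^ 2 / 2 + F y

/-- `h_ψ(y, x) = ψ(y) + h(y, x)`. -/
def genFunPsi {d : ℕ} (F ψ : E d → ℝ) (y x : E d) : ℝ := ψ y + genFun F y x

/-- `ψ` is the stationary solution of the inviscid equation: a continuous periodic function with
`ψ 0 = 0` that is a fixed point of the Lax-Oleinik operator,
`ψ(x) = min_y (ψ(y) + h(y, x))` for all `x`. -/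
structure IsStationarySolution {d : ℕ} (F ψ : E d → ℝ) : Prop where
  continuous : Continuous ψ
  periodic : IsPeriodic ψ
  map_zero : ψ 0 = 0
  fixed : ∀ x : E d, IsLeast (range fun y => genFunPsi F ψ y x) (ψ x)

/-- The set `argmin h_ψ(·, x)`. -/
def argminPsi {d : ℕ} (F ψ : E d → ℝ) (x : E d) : Set (E d) :=
  {y | ∀ z, genFunPsi F ψ y x ≤ genFunPsi F ψ z x}

/-- The twist map `Φ(x, p) = (x + p + ∇F(x), p + ∇F(x))`, with its inverse. -/
def twistMap {d : ℕ} (F : E d → ℝ) : E d × E d ≃ E d × E d where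
  toFun z := (z.1 + z.2 + gradient F z.1, z.2 + gradient F z.1)
  invFun z := (z.1 - z.2, z.2 - gradient F (z.1 - z.2))
  left_inv z := by
    have h : z.1 + z.2 + gradient F z.1 - (z.2 + gradient F z.1) = z.1 := by abel
    ext1
    · exact h
    · simp only [h]; abel
  right_inv z := by
    ext1
    · simp only; abel
    · simp only; abel

/-- The pseudograph `𝒢_ψ = {(x, ∇ψ(x)) : ψ differentiable at x}`. -/
def pseudograph {d : ℕ} (ψ : E d → ℝ) : Set (E d × E d) :=
  {z | DifferentiableAt ℝ ψ z.1 ∧ z.2 = gradient ψ z.1}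

/-- The set `𝒟⁻(ψ) = π₁ Φ⁻¹(closure 𝒢_ψ)`. -/
def Dminus {d : ℕ} (F ψ : E d → ℝ) : Set (E d) :=
  Prod.fst '' ((twistMap F).symm '' closure (pseudograph ψ))

/-- The open neighbourhoods `U` of `𝒟⁻(ψ)` on which `ψ` is `C³` with bounded second derivatives
and on which the minimum of `h_ψ(·, x)` is uniformly non-degenerate. -/
structure IsNondegNhd {d : ℕ} (F ψ : E d → ℝ) (U : Set (E d)) : Prop where
  isOpen : IsOpen U
  subset : Dminus F ψ ⊆ U
  contDiffOn : ContDiffOn ℝ 3 ψ U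
  bounded : ∃ K : ℝ, ∀ x ∈ U, ‖secondDeriv ψ x‖ ≤ K
  nondeg : ∃ δ : ℝ, 0 < δ ∧
    (∀ x ∈ U, ∀ ybar ∈ argminPsi F ψ x, ∀ y : E d,
      δ * ‖y - ybar‖ ^ 2 ≤ genFunPsi F ψ y x - genFunPsi F ψ ybar x) ∧
    (∀ x : E d, ∀ ybar ∈ argminPsi F ψ x, ∀ y : E d, y ∉ U →
      δ ≤ genFunPsi F ψ y x - genFunPsi F ψ ybar x)

/-- The space `ℝ^{nd} = (ℝ^d)^n` with its Euclidean norm. The entry with index `i = 0, …, n - 1`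
of `X = (x_{-n}, …, x_{-1})` is `x_{-n+i}`. -/
abbrev Config (d n : ℕ) : Type := PiLp 2 (fun _ : Fin n => E d)

/-- The chain `(x_{-n}, …, x_{-1}, x_0)` with `x_0 = x`. -/
def chain {d n : ℕ} (X : Config d n) (x : E d) : Fin (n + 1) → E d :=
  Fin.snoc (α := fun _ => E d) (fun i => X i) x

/-- `H_{n,x}(X) = ∑_{i=-n}^{-1} h(x_i, x_{i+1}) + ψ(x_{-n}) - ψ(x)`. -/
def action {d : ℕ} (F ψ : E d → ℝ) (n : ℕ) (x : E d) (X : Config d n) : ℝ :=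
  (∑ i : Fin n, genFun F (chain X x i.castSucc) (chain X x i.succ)) + ψ (chain X x 0) - ψ x

/-- The configuration `X*(x) = (x*_{-n}, …, x*_{-1})`, `x*_{-k} = π₁ Φ^{-k}(x, ∇ψ(x))`. -/
def minConfig {d : ℕ} (F ψ : E d → ℝ) (n : ℕ) (x : E d) : Config d n :=
  WithLp.toLp 2 (fun i : Fin n => ((twistMap F).symm^[n - (i : ℕ)] (x, gradient ψ x)).1)

/-- The Hessian `𝒜*_{n,x} = D² H_{n,x}(X*(x))`, as a bilinear form on `ℝ^{nd}`. -/
def hessianStar {d : ℕ} (F ψ : E d → ℝ) (n : ℕ) (x : E d) :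
    Config d n →L[ℝ] Config d n →L[ℝ] ℝ :=
  secondDeriv (action F ψ n x) (minConfig F ψ n x)

end KickedHJ

end

open Set

noncomputable section

namespace KickedHJ

open Filter Topology

/-! ### Superposition operators on square summable sequences -/

section SequenceSpace

variable {V : Type*} [NormedAddCommGroup V]

/-! Adding and subtracting `ψ` at the intermediate points writes the action as a sum of gaps
`h_ψ(x_i, x_{i+1}) - ψ(x_{i+1}) ≥ 0` (`action_eq_sum`). All gaps vanish along the backward orbit of
`Y(x) = x - ∇ψ(x)`, which is `X*`, and nondegeneracy makes each gap at least `δ|x_i - Y(x_{i+1})|²`.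
To second order, the Hessian therefore dominates `2δ ∑ |v_i - DY v_{i+1}|²` with `v_0 = 0`
(`hessianStar_ge_sum`).

It remains to bound `|V|²` by this defect, uniformly in `n`. Near lattice points `DY` contracts:
`(D²ψ(0) + D²F(0) + 1) DY(0) = 1` with `D²ψ(0) ≥ 0` (`norm_fderiv_backMap_zero_lt_one`). Elsewhere
in `U` it is bounded, and since `F` has bounded sum along an orbit, only boundedly many steps are of
this kind (`exists_card_bad_steps_le`). A weighted Gronwall estimate concludes
(`sum_sq_le_of_few_bad_steps`).

For admissible sets the point is that `ψ` is `C³` at every minimizer. Near `0`, backward chains are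
small `ℓ²` solutions of the Euler-Lagrange equation, whose linearization at `0` is `D²F(0)` plus a
nonnegative discrete Laplacian, hence invertible. The inverse function theorem in `ℓ²` makes the
first entry a `C²` function of `x`, and `∇ψ(x) = x - Y(x)` gains a derivative (`contDiffAt_zero`).
From any minimizer a backward chain reaches the regular set, because `F` is bounded below off it,
and regularity is carried back to the start since semiconcavity of `F` makes minima at minimizers
nondegenerate (`contDiffAt_of_argminPsi`). Compactness modulo `ℤ^d` gives uniform constants. -/

/-- Square summable sequences in `V`. -/
abbrev SqSeq (V : Type*) [NormedAddCommGroup V] : Type _ := lp (fun _ : ℕ => V) 2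

lemma hasSum_sq_norm (X : SqSeq V) : HasSum (fun k => ‖X k‖ ^ 2) (‖X‖ ^ 2) := by
  simpa using lp.hasSum_norm (by norm_num) X

lemma memℓp_two_of_le (X : SqSeq V) {a : ℕ → V} {C : ℝ} (h : ∀ k, ‖a k‖ ≤ C * ‖X k‖) :
    Memℓp a 2 := by
  refine Memℓp.mono (g := fun k => C * ‖X k‖) ?_ h
  exact ((memℓp_norm_iff).2 (lp.memℓp X)).const_mul C

lemma norm_le_of_forall_apply_le {X Y : SqSeq V} {C : ℝ} (hC : 0 ≤ C)
    (h : ∀ k, ‖Y k‖ ≤ C * ‖X k‖) : ‖Y‖ ≤ C * ‖X‖ := by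
  have h1 := hasSum_sq_norm Y
  have h2 := (hasSum_sq_norm X).mul_left (C ^ 2)
  have h3 : ‖Y‖ ^ 2 ≤ C ^ 2 * ‖X‖ ^ 2 := by
    refine hasSum_le (fun k => ?_) h1 h2
    rw [← mul_pow]
    exact pow_le_pow_left₀ (norm_nonneg _) (h k) 2
  rw [← mul_pow] at h3
  exact le_of_sq_le_sq h3 (by positivity)

/-- All entries lie in one ball, so bounds that hold on balls of the finite-dimensional space become
uniform in `k`. This is why no growth condition on `g` is needed below. -/
lemma norm_apply_le (X : SqSeq V) (k : ℕ) : ‖X k‖ ≤ ‖X‖ :=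
  lp.norm_apply_le_norm (by norm_num) X k

variable [NormedSpace ℝ V]

open Classical in
/-- The diagonal operator with entries `A k`; the zero operator if `A` is unbounded. -/
def diagOp (A : ℕ → V →L[ℝ] V) : SqSeq V →L[ℝ] SqSeq V :=
  if h : ∃ C, 0 ≤ C ∧ ∀ k, ‖A k‖ ≤ C then
    LinearMap.mkContinuous
      { toFun := fun X => ⟨fun k => A k (X k), memℓp_two_of_le X fun k =>
          (A k).le_of_opNorm_le (h.choose_spec.2 k) (X k)⟩
        map_add' := fun X Y => by ext k; exact map_add (A k) (X k) (Y k)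
        map_smul' := fun c X => by ext k; exact map_smul (A k) c (X k) }
      h.choose (fun X => norm_le_of_forall_apply_le h.choose_spec.1 fun k =>
          (A k).le_of_opNorm_le (h.choose_spec.2 k) (X k))
  else 0

lemma diagOp_apply {A : ℕ → V →L[ℝ] V} {C : ℝ} (hA : ∀ k, ‖A k‖ ≤ C) (X : SqSeq V) (k : ℕ) :
    diagOp A X k = A k (X k) := by
  have h : ∃ C, 0 ≤ C ∧ ∀ k, ‖A k‖ ≤ C := ⟨C, (norm_nonneg _).trans (hA 0), hA⟩
  rw [diagOp, dif_pos h]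
  rfl

lemma norm_diagOp_le {A : ℕ → V →L[ℝ] V} {C : ℝ} (hA : ∀ k, ‖A k‖ ≤ C) : ‖diagOp A‖ ≤ C := by
  have hC : 0 ≤ C := (norm_nonneg _).trans (hA 0)
  refine ContinuousLinearMap.opNorm_le_bound _ hC fun X => ?_
  refine norm_le_of_forall_apply_le hC fun k => ?_
  rw [diagOp_apply hA]
  exact (A k).le_of_opNorm_le (hA k) _

lemma diagOp_add {A B : ℕ → V →L[ℝ] V} {C D : ℝ} (hA : ∀ k, ‖A k‖ ≤ C) (hB : ∀ k, ‖B k‖ ≤ D) :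
    diagOp (A + B) = diagOp A + diagOp B := by
  have hAB : ∀ k, ‖(A + B) k‖ ≤ C + D := fun k => (norm_add_le _ _).trans (add_le_add (hA k) (hB k))
  ext X k
  simp [diagOp_apply hAB, diagOp_apply hA, diagOp_apply hB]

lemma diagOp_sub {A B : ℕ → V →L[ℝ] V} {C D : ℝ} (hA : ∀ k, ‖A k‖ ≤ C) (hB : ∀ k, ‖B k‖ ≤ D) :
    diagOp (A - B) = diagOp A - diagOp B := by
  have hAB : ∀ k, ‖(A - B) k‖ ≤ C + D := fun k => (norm_sub_le _ _).trans (add_le_add (hA k) (hB k))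
  ext X k
  simp [diagOp_apply hAB, diagOp_apply hA, diagOp_apply hB]

lemma diagOp_smul {A : ℕ → V →L[ℝ] V} {C : ℝ} (hA : ∀ k, ‖A k‖ ≤ C) (c : ℝ) :
    diagOp (c • A) = c • diagOp A := by
  have hAB : ∀ k, ‖(c • A) k‖ ≤ |c| * C := fun k => by
    rw [Pi.smul_apply, norm_smul, Real.norm_eq_abs]
    exact mul_le_mul_of_nonneg_left (hA k) (abs_nonneg c)
  ext X k
  simp [diagOp_apply hAB, diagOp_apply hA]

lemma norm_entry_apply_le {A : ℕ → V →L[ℝ] V →L[ℝ] V} {C : ℝ} (hA : ∀ k, ‖A k‖ ≤ C)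
    (Y : SqSeq V) (k : ℕ) : ‖A k (Y k)‖ ≤ C * ‖Y‖ :=
  ((A k).le_of_opNorm_le (hA k) _).trans
    (mul_le_mul_of_nonneg_left (norm_apply_le Y k) (le_trans (norm_nonneg (A 0)) (hA 0)))

open Classical in
/-- The diagonal bilinear map with entries `A k`; the zero map if `A` is unbounded. -/
def diagBilin (A : ℕ → V →L[ℝ] V →L[ℝ] V) : SqSeq V →L[ℝ] SqSeq V →L[ℝ] SqSeq V :=
  if h : ∃ C, ∀ k, ‖A k‖ ≤ C then
    LinearMap.mkContinuous
      { toFun := fun Y => diagOp fun k => A k (Y k)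
        map_add' := fun Y Z => by
          obtain ⟨C, hC⟩ := h
          rw [← diagOp_add (norm_entry_apply_le hC Y) (norm_entry_apply_le hC Z)]
          congr 1; ext1 k; exact map_add (A k) (Y k) (Z k)
        map_smul' := fun c Y => by
          obtain ⟨C, hC⟩ := h
          rw [RingHom.id_apply, ← diagOp_smul (norm_entry_apply_le hC Y)]
          congr 1; ext1 k; exact map_smul (A k) c (Y k) }
      h.choose (fun Y => norm_diagOp_le (norm_entry_apply_le h.choose_spec Y))
  else 0

lemma diagBilin_apply {A : ℕ → V →L[ℝ] V →L[ℝ] V} {C : ℝ} (hA : ∀ k, ‖A k‖ ≤ C) (Y : SqSeq V) :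
    diagBilin A Y = diagOp fun k => A k (Y k) := by
  have h : ∃ C, ∀ k, ‖A k‖ ≤ C := ⟨C, hA⟩
  rw [diagBilin, dif_pos h]
  rfl

variable [FiniteDimensional ℝ V] {W : Type*} [NormedAddCommGroup W]

lemma exists_bound_closedBall {f : V → W} (hf : Continuous f) (R : ℝ) :
    ∃ C, 0 ≤ C ∧ ∀ x, ‖x‖ ≤ R → ‖f x‖ ≤ C := by
  have : ProperSpace V := FiniteDimensional.proper_real V
  obtain ⟨C, hC⟩ := (isCompact_closedBall (0 : V) R).exists_bound_of_continuousOn hf.continuousOn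
  exact ⟨max C 0, le_max_right _ _, fun x hx => (hC x (by simpa using hx)).trans (le_max_left _ _)⟩

lemma exists_uniform_continuity_closedBall {f : V → W} (hf : Continuous f) (R : ℝ) {ε : ℝ}
    (hε : 0 < ε) :
    ∃ δ, 0 < δ ∧ ∀ x v, ‖x‖ ≤ R → ‖v‖ ≤ δ → ‖f (x + v) - f x‖ ≤ ε := by
  have : ProperSpace V := FiniteDimensional.proper_real V
  -- The radius `R + 1` leaves room for `x + v`, since the final `δ` is at most `1`.
  have huc := (isCompact_closedBall (0 : V) (R + 1)).uniformContinuousOn_of_continuous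
    hf.continuousOn
  obtain ⟨δ, hδ, h⟩ := Metric.uniformContinuousOn_iff_le.1 huc ε hε
  refine ⟨min δ 1, by positivity, fun x v hx hv => ?_⟩
  have := h (x + v) (by
    have := norm_add_le x v
    have := hv.trans (min_le_right _ _)
    simp only [Metric.mem_closedBall, dist_zero_right]; linarith) x (by
    simp only [Metric.mem_closedBall, dist_zero_right]; linarith) (by
    rw [dist_eq_norm, add_sub_cancel_left]; exact hv.trans (min_le_left _ _))
  rwa [dist_eq_norm] at this

lemma exists_bound_along {f : V → W} (hf : Continuous f) (X : SqSeq V) :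
    ∃ C, 0 ≤ C ∧ ∀ k, ‖f (X k)‖ ≤ C := by
  obtain ⟨C, hC, hb⟩ := exists_bound_closedBall hf ‖X‖
  exact ⟨C, hC, fun k => hb _ (norm_apply_le X k)⟩

variable [NormedSpace ℝ W]

/-- Differentiability of a `C¹` map is uniform on balls. -/
lemma exists_uniform_differentiability_closedBall {f : V → W} (hf : ContDiff ℝ 1 f) (R : ℝ) {ε : ℝ}
    (hε : 0 < ε) :
    ∃ δ, 0 < δ ∧ ∀ x v, ‖x‖ ≤ R → ‖v‖ ≤ δ → ‖f (x + v) - f x - fderiv ℝ f x v‖ ≤ ε * ‖v‖ := by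
  obtain ⟨δ, hδ, h⟩ :=
    exists_uniform_continuity_closedBall (hf.continuous_fderiv one_ne_zero) R hε
  refine ⟨δ, hδ, fun x v hx hv => ?_⟩
  have := (convex_closedBall x δ).norm_image_sub_le_of_norm_fderiv_le' (f := f) (C := ε)
    (φ := fderiv ℝ f x) (x := x) (y := x + v)
    (fun z _ => (hf.differentiable one_ne_zero) z) (fun z hz => by
      have := h x (z - x) hx (by simpa [dist_eq_norm] using hz)
      simpa using this) (Metric.mem_closedBall_self hδ.le) (by simpa using hv)
  simpa using this

open Classical in
/-- The superposition operator `X ↦ (g (X k))_k`. -/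
def superpos (g : V → V) (X : SqSeq V) : SqSeq V :=
  if h : Memℓp (fun k => g (X k)) 2 then ⟨fun k => g (X k), h⟩ else 0

/-- As `g 0 = 0`, the mean value inequality on the ball of radius `‖X‖` gives `‖g (X k)‖ ≤ C ‖X k‖`,
so the default branch of `superpos` is never taken. -/
lemma superpos_apply {g : V → V} (hg : ContDiff ℝ 1 g) (h0 : g 0 = 0) (X : SqSeq V) (k : ℕ) :
    superpos g X k = g (X k) := by
  obtain ⟨C, hC, hb⟩ := exists_bound_closedBall (hg.continuous_fderiv one_ne_zero) ‖X‖
  have h : Memℓp (fun k => g (X k)) 2 := by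
    refine memℓp_two_of_le X (C := C) fun k => ?_
    have := (convex_closedBall (0 : V) ‖X‖).norm_image_sub_le_of_norm_fderiv_le (f := g) (C := C)
      (𝕜 := ℝ) (x := 0) (y := X k) (fun z _ => (hg.differentiable one_ne_zero) z)
      (fun z hz => hb z (by simpa using hz)) (by simp) (by simpa using norm_apply_le X k)
    simpa [h0] using this
  rw [superpos, dif_pos h]

/-- The derivative of the superposition operator of `g`. -/
def superposDeriv (g : V → V) (X : SqSeq V) : SqSeq V →L[ℝ] SqSeq V :=
  diagOp fun k => fderiv ℝ g (X k)

lemma superposDeriv_apply {g : V → V} (hg : ContDiff ℝ 1 g) (X Y : SqSeq V) (k : ℕ) :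
    superposDeriv g X Y k = fderiv ℝ g (X k) (Y k) := by
  obtain ⟨C, hC, hb⟩ := exists_bound_along (hg.continuous_fderiv one_ne_zero) X
  exact diagOp_apply hb Y k

lemma hasFDerivAt_of_uniform {X Y : Type*} [NormedAddCommGroup X] [NormedSpace ℝ X]
    [NormedAddCommGroup Y] [NormedSpace ℝ Y] {f : X → Y} {f' : X →L[ℝ] Y} {x : X}
    (h : ∀ ε, 0 < ε → ∃ δ, 0 < δ ∧ ∀ v, ‖v‖ ≤ δ → ‖f (x + v) - f x - f' v‖ ≤ ε * ‖v‖) :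
    HasFDerivAt f f' x := by
  rw [hasFDerivAt_iff_isLittleO_nhds_zero, Asymptotics.isLittleO_iff]
  intro ε hε
  obtain ⟨δ, hδ, h⟩ := h ε hε
  filter_upwards [Metric.closedBall_mem_nhds (0 : X) hδ] with v hv
  exact h v (by simpa using hv)

lemma continuous_of_norm_sub_le {X Y : Type*} [NormedAddCommGroup X] [NormedAddCommGroup Y]
    {f : X → Y}
    (h : ∀ x ε, 0 < ε → ∃ δ, 0 < δ ∧ ∀ v, ‖v‖ ≤ δ → ‖f (x + v) - f x‖ ≤ ε) : Continuous f := by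
  refine Metric.continuous_iff.2 fun x ε hε => ?_
  obtain ⟨δ, hδ, h⟩ := h x (ε / 2) (half_pos hε)
  refine ⟨δ, hδ, fun y hy => ?_⟩
  rw [dist_eq_norm] at hy ⊢
  have := h (y - x) hy.le
  rw [add_sub_cancel] at this
  linarith

lemma hasFDerivAt_superpos {g : V → V} (hg : ContDiff ℝ 1 g) (h0 : g 0 = 0) (X : SqSeq V) :
    HasFDerivAt (superpos g) (superposDeriv g X) X := by
  refine hasFDerivAt_of_uniform fun ε hε => ?_
  obtain ⟨δ, hδ, h⟩ := exists_uniform_differentiability_closedBall hg ‖X‖ hε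
  refine ⟨δ, hδ, fun Y hY => norm_le_of_forall_apply_le hε.le fun k => ?_⟩
  simp only [lp.coeFn_sub, lp.coeFn_add, Pi.sub_apply, superpos_apply hg h0,
    superposDeriv_apply hg, Pi.add_apply]
  exact h _ _ (norm_apply_le X k) ((norm_apply_le Y k).trans hY)

/-- The second derivative of the superposition operator of `g`. -/
def superposDeriv₂ (g : V → V) (X : SqSeq V) : SqSeq V →L[ℝ] SqSeq V →L[ℝ] SqSeq V :=
  diagBilin fun k => fderiv ℝ (fderiv ℝ g) (X k)

lemma superposDeriv₂_apply {g : V → V} (hg : ContDiff ℝ 2 g) (X Y : SqSeq V) :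
    superposDeriv₂ g X Y = diagOp fun k => fderiv ℝ (fderiv ℝ g) (X k) (Y k) := by
  obtain ⟨C, hC, hb⟩ := exists_bound_along
    ((hg.fderiv_right (m := 1) (by norm_num)).continuous_fderiv one_ne_zero) X
  exact diagBilin_apply hb Y

/-- A diagonal operator is bounded by the supremum of its entries, so the remainder is estimated
entrywise, with one `δ` for all `k`. -/
lemma hasFDerivAt_superposDeriv {g : V → V} (hg : ContDiff ℝ 2 g) (X : SqSeq V) :
    HasFDerivAt (superposDeriv g) (superposDeriv₂ g X) X := by
  have hg1 : ContDiff ℝ 1 (fderiv ℝ g) := hg.fderiv_right (by norm_num)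
  refine hasFDerivAt_of_uniform fun ε hε => ?_
  obtain ⟨δ, hδ, h⟩ := exists_uniform_differentiability_closedBall hg1 ‖X‖ hε
  refine ⟨δ, hδ, fun Y hY => ?_⟩
  obtain ⟨C1, _, h1⟩ := exists_bound_along hg1.continuous (X + Y)
  obtain ⟨C2, _, h2⟩ := exists_bound_along hg1.continuous X
  obtain ⟨C3, _, h3⟩ := exists_bound_along (hg1.continuous_fderiv one_ne_zero) X
  rw [superposDeriv₂_apply hg, superposDeriv, superposDeriv, ← diagOp_sub h1 h2,
    ← diagOp_sub
      (A := (fun k => fderiv ℝ g ((X + Y) k)) - fun k => fderiv ℝ g (X k)) (C := C1 + C2) (fun k => (norm_sub_le _ _).trans (add_le_add (h1 k) (h2 k)))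
      (norm_entry_apply_le h3 Y)]
  refine norm_diagOp_le fun k => ?_
  refine (h _ _ (norm_apply_le X k) ((norm_apply_le Y k).trans hY)).trans ?_
  exact mul_le_mul_of_nonneg_left (norm_apply_le Y k) hε.le

lemma continuous_superposDeriv₂ {g : V → V} (hg : ContDiff ℝ 2 g) :
    Continuous (superposDeriv₂ g) := by
  have hc : Continuous (fderiv ℝ (fderiv ℝ g)) :=
    (hg.fderiv_right (m := 1) (by norm_num)).continuous_fderiv one_ne_zero
  refine continuous_of_norm_sub_le (X := SqSeq V) (Y := SqSeq V →L[ℝ] SqSeq V →L[ℝ] SqSeq V)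
    fun X ε hε => ?_
  obtain ⟨δ, hδ, h⟩ := exists_uniform_continuity_closedBall hc ‖X‖ hε
  refine ⟨δ, hδ, fun Y hY => ?_⟩
  refine ContinuousLinearMap.opNorm_le_bound _ hε.le fun Z => ?_
  obtain ⟨C1, _, h1⟩ := exists_bound_along hc X
  obtain ⟨C2, _, h2⟩ := exists_bound_along hc (X + Y)
  rw [sub_apply, superposDeriv₂_apply hg, superposDeriv₂_apply hg,
    ← diagOp_sub (norm_entry_apply_le h2 Z) (norm_entry_apply_le h1 Z)]
  refine norm_diagOp_le fun k => ?_
  have hk := h (X k) (Y k) (norm_apply_le X k) ((norm_apply_le Y k).trans hY)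
  rw [Pi.sub_apply, ← sub_apply]
  exact (ContinuousLinearMap.le_of_opNorm_le _ hk _).trans
    (mul_le_mul_of_nonneg_left (norm_apply_le Z k) hε.le)

theorem contDiff_superpos {g : V → V} (hg : ContDiff ℝ 2 g) (h0 : g 0 = 0) :
    ContDiff ℝ 2 (superpos g) := by
  rw [show (2 : WithTop ℕ∞) = (1 : ℕ) + 1 by norm_num, contDiff_succ_iff_hasFDerivAt]
  refine ⟨superposDeriv g, ?_, hasFDerivAt_superpos (hg.of_le (by norm_num)) h0⟩
  rw [Nat.cast_one, contDiff_one_iff_hasFDerivAt]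
  exact ⟨superposDeriv₂ g, continuous_superposDeriv₂ hg, hasFDerivAt_superposDeriv hg⟩

end SequenceSpace

/-! ### Shift operators -/

section Shifts

variable {V : Type*} [NormedAddCommGroup V]

lemma memℓp_two_of_summable {a : ℕ → V} (h : Summable fun k => ‖a k‖ ^ 2) : Memℓp a 2 := by
  refine memℓp_gen ?_
  simpa using h

lemma norm_le_of_hasSum_sq {X Y : SqSeq V} (h : ∀ s, HasSum (fun k => ‖Y k‖ ^ 2) s → s ≤ ‖X‖ ^ 2) :
    ‖Y‖ ≤ 1 * ‖X‖ := by
  rw [one_mul]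
  exact le_of_sq_le_sq (h _ (hasSum_sq_norm Y)) (norm_nonneg _)

/-- Prepend `0` to a sequence. -/
def consZero (a : ℕ → V) : ℕ → V
  | 0 => 0
  | k + 1 => a k

variable [NormedSpace ℝ V]

/-- The left shift `(X k)_k ↦ (X (k + 1))_k`. -/
def shiftLeft : SqSeq V →L[ℝ] SqSeq V :=
  LinearMap.mkContinuous
    { toFun := fun X => ⟨fun k => X (k + 1), memℓp_two_of_summable
        ((summable_nat_add_iff 1).2 (hasSum_sq_norm X).summable)⟩
      map_add' := fun X Y => rfl
      map_smul' := fun c X => rfl } 1 fun X => norm_le_of_hasSum_sq fun s hs => by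
    have h1 := (hasSum_nat_add_iff (f := fun k => ‖X k‖ ^ 2) 1).1 hs
    have h2 := h1.unique (hasSum_sq_norm X)
    simp only [Finset.range_one, Finset.sum_singleton] at h2
    nlinarith [sq_nonneg ‖X 0‖]

/-- The right shift `(X k)_k ↦ (0, X 0, X 1, …)`. -/
def shiftRight : SqSeq V →L[ℝ] SqSeq V :=
  LinearMap.mkContinuous
    { toFun := fun X => ⟨consZero X, memℓp_two_of_summable
        ((summable_nat_add_iff 1).1 (hasSum_sq_norm X).summable)⟩
      map_add' := fun X Y => by ext k; cases k with
        | zero => exact (add_zero (0 : V)).symm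
        | succ k => rfl
      map_smul' := fun c X => by ext k; cases k with
        | zero => exact (smul_zero c).symm
        | succ k => rfl } 1 fun X => norm_le_of_hasSum_sq fun s hs => by
    have h1 : HasSum (fun k => ‖consZero X (k + 1)‖ ^ 2) s :=
      (hasSum_nat_add_iff (f := fun k => ‖consZero X k‖ ^ 2) 1).2 (by simpa [consZero] using hs)
    exact (h1.unique (hasSum_sq_norm X)).le

lemma shiftRight_apply_zero (X : SqSeq V) : shiftRight X 0 = 0 := rfl

lemma shiftRight_apply_succ (X : SqSeq V) (k : ℕ) : shiftRight X (k + 1) = X k := rfl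

lemma norm_shiftLeft_le (X : SqSeq V) : ‖shiftLeft X‖ ≤ ‖X‖ := by
  have h := (shiftLeft (V := V)).le_of_opNorm_le (LinearMap.mkContinuous_norm_le _ zero_le_one _) X
  rwa [one_mul] at h

lemma norm_shiftRight_le (X : SqSeq V) : ‖shiftRight X‖ ≤ ‖X‖ := by
  have h := (shiftRight (V := V)).le_of_opNorm_le (LinearMap.mkContinuous_norm_le _ zero_le_one _) X
  rwa [one_mul] at h

end Shifts

/-! ### The Euler-Lagrange equation as an operator equation in `ℓ²` -/

section Chains

variable {V : Type*} [NormedAddCommGroup V] [InnerProductSpace ℝ V] [FiniteDimensional ℝ V]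

/-- The second order difference operator
`X ↦ (g (X k) + 2 X k - X (k + 1) - X (k - 1))_k`, with `X (-1) = 0`. -/
def chainOp (g : V → V) (X : SqSeq V) : SqSeq V :=
  superpos g X +
    ((2 : ℝ) • ContinuousLinearMap.id ℝ (SqSeq V) - shiftLeft - shiftRight : SqSeq V →L[ℝ] SqSeq V) X

lemma inner_superposDeriv_zero {g : V → V} (hg : ContDiff ℝ 1 g) {β : ℝ}
    (hβ : ∀ v, β * ‖v‖ ^ 2 ≤ inner ℝ (fderiv ℝ g 0 v) v) (X : SqSeq V) :
    β * ‖X‖ ^ 2 ≤ inner ℝ (superposDeriv g 0 X) X := by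
  refine hasSum_le (fun k => ?_) ((hasSum_sq_norm X).mul_left β) (lp.hasSum_inner _ _)
  rw [superposDeriv_apply hg]
  exact hβ _

/-- The derivative of `chainOp g` at `0`. -/
def chainOpDeriv (g : V → V) : SqSeq V →L[ℝ] SqSeq V :=
  superposDeriv g 0 + ((2 : ℝ) • ContinuousLinearMap.id ℝ (SqSeq V) - shiftLeft - shiftRight)

/-- Both shifts have norm at most `1`, so the discrete Laplacian part `2 - shiftLeft - shiftRight`
is nonnegative and the bound `β` for `Dg(0)` survives. -/
lemma inner_chainOpDeriv {g : V → V} (hg : ContDiff ℝ 1 g) {β : ℝ}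
    (hβ : ∀ v, β * ‖v‖ ^ 2 ≤ inner ℝ (fderiv ℝ g 0 v) v) (X : SqSeq V) :
    β * ‖X‖ ^ 2 ≤ inner ℝ (chainOpDeriv g X) X := by
  have h1 := inner_superposDeriv_zero hg hβ X
  have h2 := (real_inner_le_norm (shiftLeft X) X).trans
    (mul_le_mul_of_nonneg_right (norm_shiftLeft_le X) (norm_nonneg X))
  have h3 := (real_inner_le_norm (shiftRight X) X).trans
    (mul_le_mul_of_nonneg_right (norm_shiftRight_le X) (norm_nonneg X))
  have h4 : inner ℝ (chainOpDeriv g X) X = inner ℝ (superposDeriv g 0 X) X + (2 * ‖X‖ ^ 2 -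
      inner ℝ (shiftLeft X) X - inner ℝ (shiftRight X) X) := by
    simp only [chainOpDeriv, add_apply, sub_apply, smul_apply,
      ContinuousLinearMap.id_apply, inner_add_left, inner_sub_left, inner_smul_left]
    rw [real_inner_self_eq_norm_sq]; simp
  rw [h4]; nlinarith

/-- Lax-Milgram; this is the invertibility required by the inverse function theorem. -/
lemma exists_equiv_chainOpDeriv {g : V → V} (hg : ContDiff ℝ 1 g) {β : ℝ} (hβ0 : 0 < β)
    (hβ : ∀ v, β * ‖v‖ ^ 2 ≤ inner ℝ (fderiv ℝ g 0 v) v) :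
    ∃ e : SqSeq V ≃L[ℝ] SqSeq V, (e : SqSeq V →L[ℝ] SqSeq V) = chainOpDeriv g := by
  let B : SqSeq V →L[ℝ] SqSeq V →L[ℝ] ℝ := (innerSL ℝ).comp (chainOpDeriv g)
  have hB : IsCoercive B := ⟨β, hβ0, fun X => by
    have := inner_chainOpDeriv hg hβ X
    simpa [B, pow_two, mul_assoc] using this⟩
  refine ⟨hB.continuousLinearEquivOfBilin, ?_⟩
  ext1 X
  exact (hB.unique_continuousLinearEquivOfBilin (fun w => rfl)).symm

/-- Decaying solutions of `g (X k) + 2 X k - X (k + 1) - X (k - 1) = 0` near `0` depend on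
`X (-1)` in a `C²` way. -/
theorem exists_contDiffAt_first_entry {g : V → V} (hg : ContDiff ℝ 2 g) (h0 : g 0 = 0) {β : ℝ}
    (hβ0 : 0 < β) (hβ : ∀ v, β * ‖v‖ ^ 2 ≤ inner ℝ (fderiv ℝ g 0 v) v) :
    ∃ Y : V → V, ContDiffAt ℝ 2 Y 0 ∧ ∃ ρ, 0 < ρ ∧ ∀ X : SqSeq V, ‖X‖ < ρ →
      (∀ k, g (X (k + 1)) + (2 : ℝ) • X (k + 1) - X (k + 2) - X k = 0) →
      Y (g (X 0) + (2 : ℝ) • X 0 - X 1) = X 0 := by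
  have hg1 : ContDiff ℝ 1 g := hg.of_le (by norm_num)
  obtain ⟨e, he⟩ := exists_equiv_chainOpDeriv hg1 hβ0 hβ
  have hQ : ContDiffAt ℝ 2 (chainOp g) 0 :=
    ((contDiff_superpos hg h0).add (ContinuousLinearMap.contDiff _)).contDiffAt
  have hQ' : HasFDerivAt (chainOp g) (e : SqSeq V →L[ℝ] SqSeq V) 0 := by
    rw [he]
    exact (hasFDerivAt_superpos hg1 h0 0).add (ContinuousLinearMap.hasFDerivAt _)
  have hQ0 : chainOp g 0 = 0 := by
    have : superpos g 0 = 0 := by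
      ext k
      rw [superpos_apply hg1 h0]
      exact h0
    rw [chainOp, this, map_zero, add_zero]
  have h2 : (2 : WithTop ℕ∞) ≠ 0 := by norm_num
  have hS := hQ.to_localInverse hQ' h2
  rw [hQ0] at hS
  have hleft := (hQ.hasStrictFDerivAt' hQ' h2).eventually_left_inverse
  obtain ⟨ρ, hρ, hball⟩ := Metric.eventually_nhds_iff.1 hleft
  -- The boundary value `x = X (-1)` enters only the equation at index `0`, so the sequence is the
  -- local inverse at `(x, 0, 0, …)`.
  refine ⟨fun x => lp.evalCLM ℝ _ 2 0 (hQ.localInverse hQ' h2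
    (lp.singleContinuousLinearMap ℝ (fun _ : ℕ => V) 2 0 x)), ?_, ρ, hρ, fun X hX hE => ?_⟩
  · refine (ContinuousLinearMap.contDiff _).contDiffAt.comp _ ?_
    refine ContDiffAt.comp (0 : V) ?_ (ContinuousLinearMap.contDiff _).contDiffAt
    rwa [map_zero]
  · have hX' := hball (y := X) (by simpa using hX)
    have : chainOp g X = lp.singleContinuousLinearMap ℝ (fun _ : ℕ => V) 2 0
        (g (X 0) + (2 : ℝ) • X 0 - X 1) := by
      ext k
      rw [lp.singleContinuousLinearMap_apply]
      have hk : chainOp g X k = g (X k) + ((2 : ℝ) • X k - X (k + 1) - shiftRight X k) := by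
        rw [← superpos_apply hg1 h0]; rfl
      rw [hk]
      cases k with
      | zero => rw [lp.single_apply_self, shiftRight_apply_zero]; abel
      | succ k =>
        rw [lp.single_apply_ne _ _ _ (Nat.succ_ne_zero k), shiftRight_apply_succ, ← hE k]; abel
    rw [this] at hX'
    exact congrArg (fun Z : SqSeq V => Z 0) hX'

end Chains

/-! ### Periodicity and compactness modulo the lattice -/

section Lattice

variable {d : ℕ}

lemma latticeVec_zero : latticeVec (0 : Fin d → ℤ) = 0 := by
  ext i; simp [latticeVec]

lemma latticeVec_neg (k : Fin d → ℤ) : latticeVec (-k) = -latticeVec k := by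
  ext i; simp [latticeVec]

lemma latticeVec_add (k l : Fin d → ℤ) : latticeVec (k + l) = latticeVec k + latticeVec l := by
  ext i; simp [latticeVec]

lemma exists_norm_add_latticeVec_le (x : E d) : ∃ k, ‖x + latticeVec k‖ ≤ √d := by
  refine ⟨fun i => -⌊x i⌋, ?_⟩
  rw [EuclideanSpace.norm_eq]
  refine Real.sqrt_le_sqrt ?_
  calc ∑ i, ‖(x + latticeVec fun i => -⌊x i⌋) i‖ ^ 2 ≤ ∑ _i : Fin d, (1 : ℝ) := by
        refine Finset.sum_le_sum fun i _ => ?_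
        have : (x + latticeVec fun i => -⌊x i⌋) i = Int.fract (x i) := by
          simp [latticeVec, Int.fract, sub_eq_add_neg]
        rw [this, Real.norm_eq_abs, sq_abs]
        have h0 := Int.fract_nonneg (x i)
        have h1 := (Int.fract_lt_one (x i)).le
        nlinarith
    _ = d := by simp

lemma IsPeriodic.fderiv_add_latticeVec {f : E d → ℝ} (hf : IsPeriodic f) (k : Fin d → ℤ)
    (x : E d) : fderiv ℝ f (x + latticeVec k) = fderiv ℝ f x := by
  rw [← fderiv_comp_add_right]
  exact congrArg (fun g => fderiv ℝ g x) (funext (hf k))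

lemma IsPeriodic.gradient_add_latticeVec {f : E d → ℝ} (hf : IsPeriodic f) (k : Fin d → ℤ)
    (x : E d) : gradient f (x + latticeVec k) = gradient f x := by
  rw [gradient, gradient, hf.fderiv_add_latticeVec]

lemma IsPeriodic.secondDeriv_add_latticeVec {f : E d → ℝ} (hf : IsPeriodic f) (k : Fin d → ℤ)
    (x : E d) : secondDeriv f (x + latticeVec k) = secondDeriv f x := by
  rw [secondDeriv, secondDeriv, ← fderiv_comp_add_right]
  exact congrArg (fun g => fderiv ℝ g x) (funext (hf.fderiv_add_latticeVec k))

lemma IsPeriodic.contDiffAt_of_add_latticeVec {f : E d → ℝ} (hf : IsPeriodic f) {k : Fin d → ℤ}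
    {x : E d} {n : WithTop ℕ∞} (h : ContDiffAt ℝ n f (x + latticeVec k)) : ContDiffAt ℝ n f x := by
  have : f = f ∘ fun y => y + latticeVec k := funext fun y => (hf k y).symm
  rw [this]
  exact h.comp x (contDiffAt_id.add contDiffAt_const)

/-- The ball of radius `√d` meets every class modulo `ℤ^d`, so the minimum over its compact
intersection with `C` serves for all of `C`. It is applied to `F` on closed sets avoiding the
lattice. -/
lemma IsPeriodic.exists_pos_le {f : E d → ℝ} (hf : IsPeriodic f) (hc : Continuous f)
    {C : Set (E d)} (hC : IsClosed C) (hCp : ∀ k, ∀ x ∈ C, x + latticeVec k ∈ C)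
    (hpos : ∀ x ∈ C, 0 < f x) : ∃ η, 0 < η ∧ ∀ x ∈ C, η ≤ f x := by
  have hK : IsCompact (C ∩ Metric.closedBall 0 (√d)) := (isCompact_closedBall _ _).inter_left hC
  obtain hE | hE := (C ∩ Metric.closedBall 0 (√d)).eq_empty_or_nonempty
  · refine ⟨1, one_pos, fun x hx => ?_⟩
    obtain ⟨k, hk⟩ := exists_norm_add_latticeVec_le x
    have : x + latticeVec k ∈ C ∩ Metric.closedBall 0 (√d) := ⟨hCp k x hx, by simpa using hk⟩
    simp [hE] at this
  · obtain ⟨z, hz, hmin⟩ := hK.exists_isMinOn hE hc.continuousOn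
    refine ⟨f z, hpos z hz.1, fun x hx => ?_⟩
    obtain ⟨k, hk⟩ := exists_norm_add_latticeVec_le x
    rw [← hf k x]
    exact hmin ⟨hCp k x hx, by simpa using hk⟩

lemma IsPeriodic.exists_le {f : E d → ℝ} (hf : IsPeriodic f) (hc : Continuous f) :
    ∃ S, ∀ x, f x ≤ S := by
  obtain ⟨S, hS⟩ := (isCompact_closedBall (0 : E d) (√d)).exists_bound_of_continuousOn
    hc.continuousOn
  refine ⟨S, fun x => ?_⟩
  obtain ⟨k, hk⟩ := exists_norm_add_latticeVec_le x
  rw [← hf k x]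
  exact (le_abs_self _).trans (hS _ (by simpa using hk))

end Lattice

/-! ### Second order calculus -/

section Calculus

variable {V : Type*} [NormedAddCommGroup V] [InnerProductSpace ℝ V]

/-- A `C²` function is strongly convex near a point where its second derivative is coercive. -/
lemma exists_ball_strongly_convex {f : V → ℝ} {x : V} (hf : ContDiffAt ℝ 2 f x) {c : ℝ}
    (hc : 0 < c) (hB : ∀ v, c * ‖v‖ ^ 2 ≤ secondDeriv f x v v) :
    ∃ ρ, 0 < ρ ∧ ∀ y ∈ Metric.ball x ρ, ∀ z ∈ Metric.ball x ρ,
      c / 4 * ‖z - y‖ ^ 2 ≤ f z - f y - fderiv ℝ f y (z - y) := by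
  have h1 : ContDiffAt ℝ 1 (fderiv ℝ f) x := hf.fderiv_right (by norm_num)
  -- An error `c / 2` in the linearization of `Df` leaves slope at least `c / 2` along segments;
  -- integrating that gives `c / 4`.
  have hs := (h1.hasStrictFDerivAt one_ne_zero).isLittleO.def (half_pos hc)
  have hd : ∀ᶠ y in 𝓝 x, DifferentiableAt ℝ f y :=
    (hf.eventually (by simp)).mono fun y hy => hy.differentiableAt (by norm_num)
  obtain ⟨ρ₁, hρ₁, hs⟩ := Metric.eventually_nhds_iff_ball.1 hs
  obtain ⟨ρ₂, hρ₂, hd⟩ := Metric.eventually_nhds_iff_ball.1 hd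
  refine ⟨min ρ₁ ρ₂, lt_min hρ₁ hρ₂, fun y hy z hz => ?_⟩
  set v := z - y with hv
  have hseg : ∀ t ∈ Icc (0 : ℝ) 1, y + t • v ∈ Metric.ball x (min ρ₁ ρ₂) := fun t ht => by
    have := (convex_ball x (min ρ₁ ρ₂)).add_smul_sub_mem hy hz ht
    simpa using this
  have hmono : ∀ t ∈ Icc (0 : ℝ) 1,
      c / 2 * t * ‖v‖ ^ 2 ≤ fderiv ℝ f (y + t • v) v - fderiv ℝ f y v := fun t ht => by
    obtain rfl | ht0 := ht.1.eq_or_lt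
    · simp
    have hb : (y + t • v, y) ∈ Metric.ball (x, x) ρ₁ := by
      rw [← ball_prod_same]
      exact ⟨Metric.ball_subset_ball (min_le_left _ _) (hseg t ht),
        Metric.ball_subset_ball (min_le_left _ _) hy⟩
    have h := hs _ hb
    simp only [add_sub_cancel_left] at h
    have h2 := (ContinuousLinearMap.le_opNorm _ v).trans
      (mul_le_mul_of_nonneg_right h (norm_nonneg v))
    have h3 := neg_le_of_abs_le h2
    simp only [sub_apply, map_smul, smul_apply, smul_eq_mul, norm_smul,
      Real.norm_eq_abs, abs_of_pos ht0] at h3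
    have h4 := hB v
    rw [secondDeriv] at h4
    nlinarith
  let φ : ℝ → ℝ := fun t => f (y + t • v) - t * fderiv ℝ f y v - c / 4 * t ^ 2 * ‖v‖ ^ 2
  have hφ : ∀ t ∈ Icc (0 : ℝ) 1, HasDerivAt φ
      (fderiv ℝ f (y + t • v) v - fderiv ℝ f y v - c / 2 * t * ‖v‖ ^ 2) t := fun t ht => by
    have e1 : HasDerivAt (fun t : ℝ => y + t • v) v t := by
      simpa using ((hasDerivAt_id t).smul_const v).const_add y
    have e2 := (hd _ (Metric.ball_subset_ball (min_le_right _ _) (hseg t ht))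
      ).hasFDerivAt.comp_hasDerivAt t e1
    have e3 := (hasDerivAt_id t).mul_const (fderiv ℝ f y v)
    have e4 := (((hasDerivAt_id t).pow 2).const_mul (c / 4)).mul_const (‖v‖ ^ 2)
    refine ((e2.sub e3).sub e4).congr_deriv ?_
    simp only [id]; push_cast; ring
  have hm : MonotoneOn φ (Icc 0 1) := by
    refine monotoneOn_of_deriv_nonneg (convex_Icc 0 1)
      (fun t ht => (hφ t ht).continuousAt.continuousWithinAt)
      (fun t ht => (hφ t (interior_subset ht)).differentiableAt.differentiableWithinAt)
      (fun t ht => ?_)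
    rw [(hφ t (interior_subset ht)).deriv]
    linarith [hmono t (interior_subset ht)]
  have := hm (left_mem_Icc.2 zero_le_one) (right_mem_Icc.2 zero_le_one) zero_le_one
  simp only [φ, zero_smul, add_zero, one_smul, hv, add_sub_cancel] at this
  rw [← hv] at this
  linarith

/-- Second order Taylor expansion along a line. -/
lemma tendsto_second_order {f : V → ℝ} {x : V} (hf : ContDiffAt ℝ 2 f x) (v : V) :
    Tendsto (fun t : ℝ => (f (x + t • v) - f x - t * fderiv ℝ f x v) / t ^ 2) (𝓝[≠] 0)
      (𝓝 (secondDeriv f x v v / 2)) := by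
  have h1 : ContDiffAt ℝ 1 (fderiv ℝ f) x := hf.fderiv_right (by norm_num)
  have hd : ∀ᶠ y in 𝓝 x, DifferentiableAt ℝ f y :=
    (hf.eventually (by simp)).mono fun y hy => hy.differentiableAt (by norm_num)
  have e1 : ∀ t : ℝ, HasDerivAt (fun t : ℝ => x + t • v) v t := fun t => by
    simpa using ((hasDerivAt_id t).smul_const v).const_add x
  have hline : Tendsto (fun t : ℝ => x + t • v) (𝓝 0) (𝓝 x) := by
    have := (e1 0).continuousAt.tendsto
    simpa using this
  have hN : ∀ᶠ t : ℝ in 𝓝[≠] 0, HasDerivAt (fun t => f (x + t • v) - f x - t * fderiv ℝ f x v)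
      (fderiv ℝ f (x + t • v) v - fderiv ℝ f x v) t := by
    refine ((hline.eventually hd).filter_mono nhdsWithin_le_nhds).mono fun t ht => ?_
    have := ((ht.hasFDerivAt.comp_hasDerivAt t (e1 t)).sub_const (f x)).sub
      ((hasDerivAt_id t).mul_const (fderiv ℝ f x v))
    exact this.congr_deriv (by rw [one_mul])
  -- One use of l'Hôpital's rule reduces the claim to the derivative at `0` of `t ↦ Df(x + t v) v`.
  refine HasDerivAt.lhopital_zero_nhdsNE (g' := fun t => 2 * t) hN
    (Eventually.of_forall fun t => by simpa using hasDerivAt_pow 2 t) ?_ ?_ ?_ ?_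
  · filter_upwards [self_mem_nhdsWithin] with t ht
    simpa using ht
  · have := (hf.continuousAt.tendsto.comp hline).sub_const (f x)
    have h2 : Tendsto (fun t : ℝ => t * fderiv ℝ f x v) (𝓝 0) (𝓝 (0 * fderiv ℝ f x v)) :=
      tendsto_id.mul_const _
    simpa using (this.sub h2).mono_left nhdsWithin_le_nhds
  · have h2 : Tendsto (fun t : ℝ => t ^ 2) (𝓝 0) (𝓝 (0 ^ 2)) := tendsto_id.pow 2
    simpa using h2.mono_left nhdsWithin_le_nhds
  · have hG : HasDerivAt (fun t : ℝ => fderiv ℝ f (x + t • v) v) (secondDeriv f x v v) 0 := by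
      have h3 : HasFDerivAt (fderiv ℝ f) (secondDeriv f x) (x + (0 : ℝ) • v) := by
        rw [zero_smul, add_zero]
        exact (h1.differentiableAt one_ne_zero).hasFDerivAt
      exact (ContinuousLinearMap.apply ℝ ℝ v).hasFDerivAt.comp_hasDerivAt 0
        (h3.comp_hasDerivAt 0 (e1 0))
    have h4 := hG.tendsto_slope_zero.div_const 2
    refine h4.congr' ?_
    filter_upwards [self_mem_nhdsWithin] with t ht
    have ht : t ≠ 0 := ht
    simp only [zero_add, zero_smul, add_zero, smul_eq_mul]
    field_simp

/-- Quadratic bound for the first order Taylor remainder. -/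
lemma abs_sub_sub_fderiv_le {f : V → ℝ} {s : Set V} (hs : Convex ℝ s) {K : ℝ} (hK0 : 0 ≤ K)
    (hf : ∀ x ∈ s, ContDiffAt ℝ 2 f x) (hK : ∀ x ∈ s, ‖secondDeriv f x‖ ≤ K) {x y : V}
    (hx : x ∈ s) (hy : y ∈ s) : |f y - f x - fderiv ℝ f x (y - x)| ≤ K * ‖y - x‖ ^ 2 := by
  have hlip : ∀ z ∈ s, ‖fderiv ℝ f z - fderiv ℝ f x‖ ≤ K * ‖z - x‖ := fun z hz =>
    hs.norm_image_sub_le_of_norm_fderiv_le (fun w hw =>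
      ((hf w hw).fderiv_right (m := 1) (by norm_num)).differentiableAt one_ne_zero) hK hx hz
  -- On this ball `Df` differs from `Df(x)` by at most `K ‖y - x‖`; the result lacks the sharp
  -- factor `1/2`, which is not needed.
  have := (hs.inter (convex_closedBall x ‖y - x‖)).norm_image_sub_le_of_norm_fderiv_le' (f := f)
    (C := K * ‖y - x‖) (φ := fderiv ℝ f x) (x := x) (y := y)
    (fun z hz => (hf z hz.1).differentiableAt (by norm_num)) (fun z hz => (hlip z hz.1).trans
      (mul_le_mul_of_nonneg_left (by simpa [dist_eq_norm] using hz.2) hK0))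
    ⟨hx, Metric.mem_closedBall_self (norm_nonneg _)⟩ ⟨hy, by simp [dist_eq_norm]⟩
  rwa [Real.norm_eq_abs, mul_assoc, ← pow_two] at this

variable [FiniteDimensional ℝ V]

lemma inner_gradient {f : V → ℝ} (x v : V) : inner ℝ (gradient f x) v = fderiv ℝ f x v := by
  rw [gradient, InnerProductSpace.toDual_symm_apply]

lemma contDiffAt_gradient {f : V → ℝ} {x : V} {m n : WithTop ℕ∞} (hf : ContDiffAt ℝ n f x)
    (hmn : m + 1 ≤ n) : ContDiffAt ℝ m (gradient f) x :=
  ((InnerProductSpace.toDual ℝ V).symm.toContinuousLinearEquiv.contDiff.contDiffAt).comp x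
    (hf.fderiv_right hmn)

lemma inner_fderiv_gradient {f : V → ℝ} {x : V} (hf : ContDiffAt ℝ 2 f x) (v w : V) :
    inner ℝ (fderiv ℝ (gradient f) x v) w = secondDeriv f x v w := by
  have h1 : DifferentiableAt ℝ (fderiv ℝ f) x :=
    (hf.fderiv_right (m := 1) (by norm_num)).differentiableAt one_ne_zero
  have h2 := ((InnerProductSpace.toDual ℝ V).symm.toContinuousLinearEquiv.toContinuousLinearMap
    ).hasFDerivAt.comp x h1.hasFDerivAt
  rw [HasFDerivAt.fderiv (f := gradient f) h2]
  exact InnerProductSpace.toDual_symm_apply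

lemma contDiffAt_of_hasGradientAt {f : V → ℝ} {G : V → V} {x : V} {n : ℕ}
    (h : ∀ᶠ y in 𝓝 x, HasGradientAt f (G y) y) (hG : ContDiffAt ℝ n G x) :
    ContDiffAt ℝ (n + 1) f x := by
  rw [contDiffAt_succ_iff_hasFDerivAt]
  exact ⟨fun y => InnerProductSpace.toDual ℝ V (G y), ⟨_, h, fun y hy => hy.hasFDerivAt⟩,
    ((InnerProductSpace.toDual ℝ V).toContinuousLinearEquiv.contDiff.contDiffAt).comp x hG⟩

lemma exists_pos_coercive (B : V →L[ℝ] V →L[ℝ] ℝ) (hB : ∀ v, v ≠ 0 → 0 < B v v) :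
    ∃ c, 0 < c ∧ ∀ v, c * ‖v‖ ^ 2 ≤ B v v := by
  have : ProperSpace V := FiniteDimensional.proper_real V
  obtain hE | hE := (Metric.sphere (0 : V) 1).eq_empty_or_nonempty
  · refine ⟨1, one_pos, fun v => ?_⟩
    by_cases hv : v = 0
    · simp [hv]
    · have : (‖v‖⁻¹ • v) ∈ Metric.sphere (0 : V) 1 := by
        simp [norm_smul, inv_mul_cancel₀ (norm_ne_zero_iff.2 hv)]
      simp [hE] at this
  · obtain ⟨z, hz, hmin⟩ := (isCompact_sphere (0 : V) 1).exists_isMinOn hE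
      (f := fun v => B v v) (by fun_prop)
    have hz0 : z ≠ 0 := by rintro rfl; simp at hz
    refine ⟨B z z, hB z hz0, fun v => ?_⟩
    by_cases hv : v = 0
    · simp [hv]
    · have hv' : ‖v‖ ≠ 0 := norm_ne_zero_iff.2 hv
      have h1 : B z z ≤ B (‖v‖⁻¹ • v) (‖v‖⁻¹ • v) :=
        hmin (by simp [norm_smul, inv_mul_cancel₀ hv'])
      simp only [map_smul, smul_apply, smul_eq_mul] at h1
      calc B z z * ‖v‖ ^ 2 ≤ (‖v‖⁻¹ * (‖v‖⁻¹ * B v v)) * ‖v‖ ^ 2 := by gcongr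
        _ = B v v := by field_simp

end Calculus

/-! ### Minimizers, first order conditions and costs of backward chains -/

section Basic

variable {d : ℕ} {F ψ : E d → ℝ}

lemma IsKickPotential.nonneg (hF : IsKickPotential F) (x : E d) : 0 ≤ F x := by
  have : (0 : E d) ∈ {x : E d | ∀ y, F x ≤ F y} := by
    rw [hF.argmin_eq]; exact ⟨0, latticeVec_zero⟩
  simpa [hF.map_zero] using this x

lemma IsKickPotential.mem_range_of_eq_zero (hF : IsKickPotential F) {x : E d} (h : F x = 0) :
    x ∈ range (latticeVec (d := d)) := by
  rw [← hF.argmin_eq]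
  intro y
  rw [h]
  exact hF.nonneg y

lemma IsKickPotential.fderiv_zero (hF : IsKickPotential F) : fderiv ℝ F 0 = 0 :=
  IsLocalMin.fderiv_eq_zero (Eventually.of_forall fun x => by
    simpa [hF.map_zero] using hF.nonneg x)

lemma IsKickPotential.gradient_zero (hF : IsKickPotential F) : gradient F 0 = 0 := by
  rw [gradient, hF.fderiv_zero]; exact LinearIsometryEquiv.map_zero _

lemma IsKickPotential.differentiable (hF : IsKickPotential F) : Differentiable ℝ F :=
  hF.contDiff.differentiable (by norm_num)

lemma IsKickPotential.contDiff_gradient (hF : IsKickPotential F) : ContDiff ℝ 2 (gradient F) :=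
  contDiff_iff_contDiffAt.2 fun _ => contDiffAt_gradient hF.contDiff.contDiffAt (by norm_num)

/-- The kick potential is globally semiconcave. -/
lemma IsKickPotential.exists_semiconcave (hF : IsKickPotential F) :
    ∃ K, 0 ≤ K ∧ ∀ x w, F (x + w) ≤ F x + inner ℝ (gradient F x) w + K * ‖w‖ ^ 2 := by
  have h1 : ContDiff ℝ 1 (fderiv ℝ F) := hF.contDiff.fderiv_right (by norm_num)
  obtain ⟨K, hK0, hK⟩ := exists_bound_closedBall (h1.continuous_fderiv one_ne_zero) (√d)
  have hb : ∀ x, ‖fderiv ℝ (fderiv ℝ F) x‖ ≤ K := fun x => by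
    obtain ⟨k, hk⟩ := exists_norm_add_latticeVec_le x
    have := hK _ hk
    rwa [← secondDeriv, hF.periodic.secondDeriv_add_latticeVec] at this
  refine ⟨K, hK0, fun x w => ?_⟩
  have := abs_sub_sub_fderiv_le convex_univ hK0
    (fun z _ => hF.contDiff.contDiffAt.of_le (by norm_num)) (fun z _ => hb z) (mem_univ x)
    (mem_univ (x + w))
  rw [add_sub_cancel_left, ← inner_gradient] at this
  linarith [(abs_le.1 this).2]

lemma IsStationarySolution.le_genFunPsi (hψ : IsStationarySolution F ψ) (y x : E d) :
    ψ x ≤ genFunPsi F ψ y x := (hψ.fixed x).2 ⟨y, rfl⟩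

lemma IsStationarySolution.mem_argminPsi_iff (hψ : IsStationarySolution F ψ) {x y : E d} :
    y ∈ argminPsi F ψ x ↔ genFunPsi F ψ y x = ψ x := by
  constructor
  · intro h
    obtain ⟨z, hz⟩ := (hψ.fixed x).1
    exact le_antisymm ((h z).trans hz.le) (hψ.le_genFunPsi y x)
  · intro h z
    rw [h]; exact hψ.le_genFunPsi z x

lemma IsStationarySolution.exists_mem_argminPsi (hψ : IsStationarySolution F ψ) (x : E d) :
    ∃ y, y ∈ argminPsi F ψ x := by
  obtain ⟨y, hy⟩ := (hψ.fixed x).1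
  exact ⟨y, hψ.mem_argminPsi_iff.2 hy⟩

lemma genFunPsi_add_latticeVec (hF : IsKickPotential F) (hψ : IsStationarySolution F ψ)
    (k : Fin d → ℤ) (y x : E d) :
    genFunPsi F ψ (y + latticeVec k) (x + latticeVec k) = genFunPsi F ψ y x := by
  simp only [genFunPsi, genFun, hψ.periodic k y, hF.periodic k y, add_sub_add_right_eq_sub]

lemma add_latticeVec_mem_argminPsi (hF : IsKickPotential F) (hψ : IsStationarySolution F ψ)
    {x y : E d} (k : Fin d → ℤ) (h : y ∈ argminPsi F ψ x) :
    y + latticeVec k ∈ argminPsi F ψ (x + latticeVec k) := by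
  rw [hψ.mem_argminPsi_iff] at h ⊢
  rw [genFunPsi_add_latticeVec hF hψ, hψ.periodic, h]

/-- Let `z` be a minimum point of `ψ` and `y` a minimizer for `z`. Then `ψ(z) = ψ(y) + |z - y|²/2 +
F(y)` forces `y = z` and `F(z) = 0`, so `z` is a lattice point and the minimum is `ψ(0) = 0`. -/
lemma IsStationarySolution.nonneg (hF : IsKickPotential F) (hψ : IsStationarySolution F ψ)
    (x : E d) : 0 ≤ ψ x := by
  obtain ⟨z, hz, hmin⟩ := (isCompact_closedBall (0 : E d) (√d)).exists_isMinOn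
    ⟨0, by simp⟩ hψ.continuous.continuousOn
  have hz : ∀ y, ψ z ≤ ψ y := fun y => by
    obtain ⟨k, hk⟩ := exists_norm_add_latticeVec_le y
    rw [← hψ.periodic k y]
    exact hmin (by simpa using hk)
  obtain ⟨y, hy⟩ := hψ.exists_mem_argminPsi z
  rw [hψ.mem_argminPsi_iff, genFunPsi, genFun] at hy
  have h1 := hz y
  have h2 := hF.nonneg y
  have h3 : 0 ≤ ‖z - y‖ ^ 2 := sq_nonneg _
  have h4 : ‖z - y‖ = 0 := by
    have : ‖z - y‖ ^ 2 = 0 := by linarith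
    exact pow_eq_zero_iff (two_ne_zero) |>.1 this
  obtain rfl : z = y := sub_eq_zero.1 (norm_eq_zero.1 h4)
  obtain ⟨k, rfl⟩ := hF.mem_range_of_eq_zero (x := z) (by rw [h4] at hy; linarith)
  have h0 : ψ (latticeVec k) = 0 := by
    rw [← zero_add (latticeVec k), hψ.periodic, hψ.map_zero]
  exact h0 ▸ hz x

lemma hasGradientAt_half_norm_sub_sq (a x : E d) :
    HasGradientAt (fun w => ‖w - a‖ ^ 2 / 2) (x - a) x := by
  rw [hasGradientAt_iff_hasFDerivAt]
  have := (((hasFDerivAt_id x).sub_const a).norm_sq).mul_const (1 / 2 : ℝ)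
  refine (this.congr_fderiv ?_).congr_of_eventuallyEq (Eventually.of_forall fun w => ?_)
  · ext v
    simp
  · simp only [id]; ring

lemma _root_.HasGradientAt.fun_add {f g : E d → ℝ} {f' g' x : E d} (hf : HasGradientAt f f' x)
    (hg : HasGradientAt g g' x) : HasGradientAt (fun w => f w + g w) (f' + g') x := by
  rw [hasGradientAt_iff_hasFDerivAt] at *
  rw [map_add]
  exact hf.add hg

lemma _root_.HasGradientAt.eq_zero_of_forall_le {f : E d → ℝ} {f' x : E d}
    (hf : HasGradientAt f f' x) (h : ∀ y, f x ≤ f y) : f' = 0 := by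
  have := IsLocalMin.hasFDerivAt_eq_zero (Eventually.of_forall h) hf.hasFDerivAt
  simpa using this

/-- The discrete Euler-Lagrange equation. -/
lemma euler_lagrange (hF : IsKickPotential F) (hψ : IsStationarySolution F ψ) {x y z : E d}
    (hy : y ∈ argminPsi F ψ x) (hz : z ∈ argminPsi F ψ y) :
    gradient F y + (2 : ℝ) • y - z - x = 0 := by
  have h := ((hF.differentiable y).hasGradientAt.fun_add (hasGradientAt_half_norm_sub_sq x y)).fun_add
    (hasGradientAt_half_norm_sub_sq z y)
  -- The bounds `ψ(w) ≤ h_ψ(z, w)` and `ψ(x) ≤ h_ψ(w, x)` are equalities at `w = y`. Adding them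
  -- removes `ψ(w)`, so `ψ` need not be differentiable at `y`.
  have := h.eq_zero_of_forall_le fun w => by
    have h1 := hψ.le_genFunPsi z w
    have h2 := hψ.le_genFunPsi w x
    rw [hψ.mem_argminPsi_iff] at hy hz
    simp only [genFunPsi, genFun, norm_sub_rev x] at *
    linarith
  rw [← this, two_smul]
  abel

lemma gradient_at_argminPsi (hF : IsKickPotential F) {x y : E d}
    (hy : y ∈ argminPsi F ψ x) (hd : DifferentiableAt ℝ ψ y) :
    gradient ψ y + gradient F y + (y - x) = 0 := by
  have h := (hd.hasGradientAt.fun_add (hF.differentiable y).hasGradientAt).fun_add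
    (hasGradientAt_half_norm_sub_sq x y)
  refine h.eq_zero_of_forall_le fun w => ?_
  have := hy w
  simp only [genFunPsi, genFun, norm_sub_rev x] at this
  linarith

/-- Envelope argument: `w ↦ h_ψ(y, w) - ψ(w)` is minimal at `x`. In particular the minimizer is
unique wherever `ψ` is differentiable. -/
lemma gradient_eq_sub (hψ : IsStationarySolution F ψ) {x y : E d}
    (hy : y ∈ argminPsi F ψ x) (hd : DifferentiableAt ℝ ψ x) : gradient ψ x = x - y := by
  have h0 := hd.hasGradientAt
  rw [hasGradientAt_iff_hasFDerivAt] at h0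
  have h : HasGradientAt (fun w => ‖w - y‖ ^ 2 / 2 + -ψ w) (x - y + -gradient ψ x) x := by
    refine (hasGradientAt_half_norm_sub_sq y x).fun_add ?_
    rw [hasGradientAt_iff_hasFDerivAt, map_neg]
    exact h0.neg
  have := h.eq_zero_of_forall_le fun w => by
    have h1 := hψ.le_genFunPsi y w
    rw [hψ.mem_argminPsi_iff] at hy
    simp only [genFunPsi, genFun] at *
    linarith
  rw [← sub_eq_add_neg, sub_eq_zero] at this
  exact this.symm

/-- A continuous selection of minimizers gives the gradient of `ψ`. -/
lemma hasGradientAt_of_selection (hψ : IsStationarySolution F ψ) {Y : E d → E d} {x : E d}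
    (hY : ∀ᶠ w in 𝓝 x, Y w ∈ argminPsi F ψ w) (hc : ContinuousAt Y x) :
    HasGradientAt ψ (x - Y x) x := by
  rw [hasGradientAt_iff_isLittleO, Asymptotics.isLittleO_iff]
  intro ε hε
  have h1 : Tendsto (fun w => ‖w - x‖ + ‖Y w - Y x‖) (𝓝 x) (𝓝 0) := by
    have : ContinuousAt (fun w => ‖w - x‖ + ‖Y w - Y x‖) x :=
      (continuousAt_id.sub continuousAt_const).norm.add (hc.sub continuousAt_const).norm
    simpa [ContinuousAt] using this
  filter_upwards [hY, h1.eventually (gt_mem_nhds hε)] with w hw hε'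
  have hx := hY.self_of_nhds
  rw [hψ.mem_argminPsi_iff] at hw hx
  -- Each minimizer competes at the other point: `Y x` at `w` bounds `ψ(w)` from above, `Y w` at `x`
  -- bounds it from below.
  have h2 := hψ.le_genFunPsi (Y x) w
  have h3 := hψ.le_genFunPsi (Y w) x
  simp only [genFunPsi, genFun] at hw hx h2 h3
  obtain ⟨e, rfl⟩ : ∃ e, w = x + e := ⟨w - x, by abel⟩
  rw [add_sub_cancel_left] at hε' ⊢
  have n1 : ‖x + e - Y x‖ ^ 2 = ‖x - Y x‖ ^ 2 + 2 * inner ℝ (x - Y x) e + ‖e‖ ^ 2 := by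
    rw [← norm_add_sq_real]; congr 2; abel
  have n2 : ‖x + e - Y (x + e)‖ ^ 2 = ‖x - Y (x + e)‖ ^ 2 + 2 * inner ℝ (x - Y (x + e)) e +
      ‖e‖ ^ 2 := by
    rw [← norm_add_sq_real]; congr 2; abel
  have n3 : inner ℝ (x - Y (x + e)) e = inner ℝ (x - Y x) e - inner ℝ (Y (x + e) - Y x) e := by
    rw [← inner_sub_left]; congr 1; abel
  have n4 := real_inner_le_norm (Y (x + e) - Y x) e
  have n5 := norm_nonneg e
  have n6 : ‖e‖ * ‖e‖ + ‖Y (x + e) - Y x‖ * ‖e‖ ≤ ε * ‖e‖ := by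
    rw [← add_mul]; exact mul_le_mul_of_nonneg_right hε'.le n5
  have n7 := mul_nonneg (norm_nonneg (Y (x + e) - Y x)) n5
  rw [Real.norm_eq_abs, abs_le]
  constructor <;> nlinarith

/-- Near `x` the gradient of `ψ` is `w - Y w`, so `ψ` is one degree smoother than the selection. -/
lemma contDiffAt_of_selection (hψ : IsStationarySolution F ψ) {Y : E d → E d} {x : E d}
    (hY : ∀ᶠ w in 𝓝 x, Y w ∈ argminPsi F ψ w) (hc : ContDiffAt ℝ 2 Y x) :
    ContDiffAt ℝ 3 ψ x := by
  have h : ∀ᶠ w in 𝓝 x, HasGradientAt ψ (w - Y w) w := by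
    filter_upwards [hY.eventually_nhds, hc.eventually (by simp)] with w hw hc
    exact hasGradientAt_of_selection hψ hw hc.continuousAt
  have := contDiffAt_of_hasGradientAt (n := 2) h (contDiffAt_id.sub hc)
  convert! this using 1

/-- The cost along a backward minimizing chain. -/
lemma sum_le_of_chain (hF : IsKickPotential F) (hψ : IsStationarySolution F ψ) {u : ℕ → E d}
    (hu : ∀ k, u (k + 1) ∈ argminPsi F ψ (u k)) (n : ℕ) :
    ∑ k ∈ Finset.range n, (F (u (k + 1)) + ‖u k - u (k + 1)‖ ^ 2 / 2) ≤ ψ (u 0) := by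
  have : ∑ k ∈ Finset.range n, (F (u (k + 1)) + ‖u k - u (k + 1)‖ ^ 2 / 2) =
      ψ (u 0) - ψ (u n) := by
    rw [← Finset.sum_range_sub' (fun k => ψ (u k))]
    refine Finset.sum_congr rfl fun k _ => ?_
    have := hψ.mem_argminPsi_iff.1 (hu k)
    simp only [genFunPsi, genFun] at this
    linarith
  rw [this]
  linarith [hψ.nonneg hF (u n)]

lemma sum_potential_le_of_chain (hF : IsKickPotential F) (hψ : IsStationarySolution F ψ)
    {u : ℕ → E d} (hu : ∀ k, u (k + 1) ∈ argminPsi F ψ (u k)) (n : ℕ) :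
    ∑ k ∈ Finset.range n, F (u (k + 1)) ≤ ψ (u 0) :=
  (Finset.sum_le_sum fun k _ => by
    have : 0 ≤ ‖u k - u (k + 1)‖ ^ 2 / 2 := by positivity
    linarith).trans (sum_le_of_chain hF hψ hu n)

/-- A choice of minimizers. -/
lemma IsStationarySolution.exists_selection (hψ : IsStationarySolution F ψ) :
    ∃ Y : E d → E d, ∀ x, Y x ∈ argminPsi F ψ x :=
  ⟨fun x => (hψ.exists_mem_argminPsi x).choose, fun x => (hψ.exists_mem_argminPsi x).choose_spec⟩

end Basic

/-! ### Regularity of the stationary solution at minimizers -/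

section Regularity

variable {d : ℕ} {F ψ : E d → ℝ}

/-- If `ψ` is bounded below by a paraboloid touching at `x`, the minimum of `h_ψ(·, x)` is
nondegenerate. -/
lemma quadratic_growth (hψ : IsStationarySolution F ψ) {x y : E d} {K : ℝ} (hK : 0 ≤ K)
    (hlow : ∀ w, ψ x + inner ℝ (x - y) w - K * ‖w‖ ^ 2 ≤ ψ (x + w)) (y' : E d) :
    1 / (2 * (2 * K + 1)) * ‖y' - y‖ ^ 2 ≤ genFunPsi F ψ y' x - ψ x := by
  obtain ⟨e, rfl⟩ : ∃ e, y' = y + e := ⟨y' - y, by abel⟩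
  rw [add_sub_cancel_left]
  -- Testing at `x + s e` gives the lower bound `(s - (K + 1/2) s²) ‖e‖²`, which this `s` maximizes.
  set s := 1 / (2 * K + 1) with hs
  have hs0 : 0 < 2 * K + 1 := by linarith
  have h1 := hlow (s • e)
  have h2 := hψ.le_genFunPsi (y + e) (x + s • e)
  simp only [genFunPsi, genFun] at h2 ⊢
  have n1 : ‖x + s • e - (y + e)‖ ^ 2 = ‖x - (y + e)‖ ^ 2 + 2 * inner ℝ (x - y - e) (s • e) +
      ‖s • e‖ ^ 2 := by
    rw [show x - y - e = x - (y + e) by abel, ← norm_add_sq_real]; congr 2; abel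
  rw [inner_sub_left, inner_smul_right, inner_smul_right, real_inner_self_eq_norm_sq, norm_smul,
    Real.norm_eq_abs, mul_pow, sq_abs] at n1
  rw [inner_smul_right, norm_smul, Real.norm_eq_abs, mul_pow, sq_abs] at h1
  have n2 : 1 / (2 * (2 * K + 1)) * ‖e‖ ^ 2 =
      s * ‖e‖ ^ 2 - (K + 1 / 2) * (s ^ 2 * ‖e‖ ^ 2) := by
    rw [hs]; field_simp; ring
  rw [n2]
  linarith

/-- Uniform nondegeneracy of the minimum of `h_ψ(·, x)` at points `x` that are minimizers
themselves. -/
lemma exists_quadratic_growth_of_mem_argminPsi (hF : IsKickPotential F)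
    (hψ : IsStationarySolution F ψ) :
    ∃ c, 0 < c ∧ ∀ x y z, x ∈ argminPsi F ψ z → y ∈ argminPsi F ψ x → ∀ y',
      c * ‖y' - y‖ ^ 2 ≤ genFunPsi F ψ y' x - ψ x := by
  obtain ⟨K, hK0, hK⟩ := hF.exists_semiconcave
  refine ⟨1 / (2 * (2 * (K + 1 / 2) + 1)), by positivity, fun x y z hx hy y' => ?_⟩
  -- Since `x` minimizes `h_ψ(·, z)`, `ψ` lies above `ψ(z) - h(·, z)` and touches it at `x`.
  -- Semiconcavity of `F` contributes `K` and the kinetic term `1/2`; the slope at `x` is `x - y` by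
  -- `euler_lagrange`.
  refine quadratic_growth hψ (by positivity) (fun w => ?_) y'
  have hEL := euler_lagrange hF hψ hx hy
  have h1 := hψ.le_genFunPsi (x + w) z
  rw [hψ.mem_argminPsi_iff] at hx
  simp only [genFunPsi, genFun] at h1 hx
  have n1 : ‖z - (x + w)‖ ^ 2 = ‖z - x‖ ^ 2 - 2 * inner ℝ (z - x) w + ‖w‖ ^ 2 := by
    rw [← norm_sub_sq_real]; congr 2; abel
  have n2 : x - y = z - x - gradient F x := by
    rw [← sub_eq_zero, ← hEL, two_smul]; abel
  rw [n2, inner_sub_left]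
  have := hK x w
  linarith

/-- As `w → x`, the point `Y w` becomes almost minimal for `h_ψ(·, x)`, and quadratic growth turns a
small excess into a small distance to `Y x`. -/
lemma continuousAt_selection (hF : IsKickPotential F) (hψ : IsStationarySolution F ψ)
    {Y : E d → E d} (hY : ∀ x, Y x ∈ argminPsi F ψ x) {x : E d} {c : ℝ} (hc : 0 < c)
    (hg : ∀ y', c * ‖y' - Y x‖ ^ 2 ≤ genFunPsi F ψ y' x - ψ x) : ContinuousAt Y x := by
  obtain ⟨S, hS⟩ := hψ.periodic.exists_le hψ.continuous
  have hS0 : 0 ≤ S := (hψ.nonneg hF 0).trans (hS 0)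
  have hb : ∀ w, c * ‖Y w - Y x‖ ^ 2 ≤
      ψ w - ψ x + ‖w - x‖ * (2 * S + 1) + ‖w - x‖ ^ 2 / 2 := fun w => by
    have h1 := hg (Y w)
    have h2 := hψ.mem_argminPsi_iff.1 (hY w)
    simp only [genFunPsi, genFun] at h1 h2
    have h3 : ‖x - Y w‖ ≤ ‖w - Y w‖ + ‖w - x‖ := by
      rw [add_comm, ← norm_sub_rev x w]
      exact norm_sub_le_norm_sub_add_norm_sub _ _ _
    have h4 : ‖w - Y w‖ ^ 2 ≤ 2 * S := by
      have := hS w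
      have := hψ.nonneg hF (Y w)
      have := hF.nonneg (Y w)
      linarith
    have h5 : ‖w - Y w‖ ≤ 2 * S + 1 := by nlinarith [norm_nonneg (w - Y w)]
    have h6 : ‖x - Y w‖ ^ 2 ≤ (‖w - Y w‖ + ‖w - x‖) ^ 2 := by gcongr
    nlinarith [norm_nonneg (w - x)]
  have hlim : Tendsto (fun w => ψ w - ψ x + ‖w - x‖ * (2 * S + 1) + ‖w - x‖ ^ 2 / 2) (𝓝 x)
      (𝓝 0) := by
    have : Continuous fun w => ψ w - ψ x + ‖w - x‖ * (2 * S + 1) + ‖w - x‖ ^ 2 / 2 := by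
      have := hψ.continuous
      fun_prop
    simpa using this.tendsto x
  rw [Metric.continuousAt_iff']
  intro ε hε
  have hpos : 0 < c * ε ^ 2 := by positivity
  filter_upwards [hlim.eventually (gt_mem_nhds hpos)] with w hw
  rw [dist_eq_norm]
  have h1 : ‖Y w - Y x‖ ^ 2 < ε ^ 2 := lt_of_mul_lt_mul_left ((hb w).trans_lt hw) hc.le
  exact lt_of_pow_lt_pow_left₀ 2 hε.le h1

/-- Iterating a selection of minimizers backwards. -/
lemma iterate_mem_argminPsi {Y : E d → E d} (hY : ∀ x, Y x ∈ argminPsi F ψ x) (x : E d) (k : ℕ) :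
    Y^[k + 1] x ∈ argminPsi F ψ (Y^[k] x) := by
  rw [Function.iterate_succ_apply']
  exact hY _

/-- Chains starting near `0` with small cost remain near `0`. -/
lemma norm_chain_lt (hF : IsKickPotential F) (hψ : IsStationarySolution F ψ) {u : ℕ → E d}
    (hu : ∀ k, u (k + 1) ∈ argminPsi F ψ (u k)) {r c : ℝ} (hr : 0 < r) (hc : 0 < c)
    (hFc : ∀ x, ‖x‖ < 2 * r → c * ‖x‖ ^ 2 ≤ F x) (h0 : ‖u 0‖ < r) (h1 : ψ (u 0) < c * r ^ 2)
    (h2 : ψ (u 0) < r ^ 2 / 2) (k : ℕ) : ‖u k‖ < r := by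
  induction k with
  | zero => exact h0
  | succ k ih =>
    have hs : F (u (k + 1)) + ‖u k - u (k + 1)‖ ^ 2 / 2 ≤ ψ (u 0) :=
      (Finset.single_le_sum (f := fun k => F (u (k + 1)) + ‖u k - u (k + 1)‖ ^ 2 / 2)
        (fun i _ => add_nonneg (hF.nonneg _) (by positivity)) (Finset.self_mem_range_succ k)).trans
        (sum_le_of_chain hF hψ hu (k + 1))
    have hFk := hF.nonneg (u (k + 1))
    have h3 : ‖u k - u (k + 1)‖ < r := by
      refine lt_of_pow_lt_pow_left₀ 2 hr.le ?_
      linarith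
    -- A jump shorter than `r` cannot leave the ball of radius `2 * r` where `F` is coercive;
    -- coercivity then brings the bound back to `r`.
    have h4 : ‖u (k + 1)‖ < 2 * r := by
      have := norm_le_norm_add_norm_sub' (u (k + 1)) (u k)
      rw [norm_sub_rev] at this
      linarith
    have h5 := hFc _ h4
    have h6 : 0 ≤ ‖u k - u (k + 1)‖ ^ 2 / 2 := by positivity
    refine lt_of_pow_lt_pow_left₀ 2 hr.le (lt_of_mul_lt_mul_left ?_ hc.le)
    linarith

/-- The sum of `F` along the chain is at most `ψ (u 0)`, and `F` dominates `c ‖x‖²`. The shift by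
one makes `u 0` the boundary value at index `-1`. -/
lemma exists_chain_sqSeq (hF : IsKickPotential F) (hψ : IsStationarySolution F ψ) {u : ℕ → E d}
    (hu : ∀ k, u (k + 1) ∈ argminPsi F ψ (u k)) {r c ρ : ℝ} (hc : 0 < c)
    (hFc : ∀ x, ‖x‖ < 2 * r → c * ‖x‖ ^ 2 ≤ F x) (hr : ∀ k, ‖u k‖ < r) (hr0 : 0 < r) (hρ : 0 < ρ)
    (h1 : ψ (u 0) < c * ρ ^ 2) : ∃ X : SqSeq (E d), ‖X‖ < ρ ∧ ∀ k, X k = u (k + 1) := by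
  have hsum : ∀ n, ∑ k ∈ Finset.range n, ‖u (k + 1)‖ ^ 2 ≤ ψ (u 0) / c := fun n => by
    rw [le_div_iff₀ hc, Finset.sum_mul]
    refine (Finset.sum_le_sum fun k _ => ?_).trans (sum_potential_le_of_chain hF hψ hu n)
    rw [mul_comm]
    exact hFc _ ((hr _).trans (by linarith))
  have hsm : Summable fun k => ‖u (k + 1)‖ ^ 2 :=
    summable_of_sum_range_le (fun k => by positivity) hsum
  let X : SqSeq (E d) := ⟨fun k => u (k + 1), memℓp_two_of_summable hsm⟩
  refine ⟨X, ?_, fun k => rfl⟩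
  refine lt_of_pow_lt_pow_left₀ 2 hρ.le ?_
  have h2 : ‖X‖ ^ 2 ≤ ψ (u 0) / c :=
    le_of_tendsto' (hasSum_sq_norm X).tendsto_sum_nat hsum
  refine h2.trans_lt ?_
  rw [div_lt_iff₀ hc, mul_comm]
  exact h1

lemma IsKickPotential.exists_coercive (hF : IsKickPotential F) :
    ∃ β, 0 < β ∧ ∀ v, β * ‖v‖ ^ 2 ≤ secondDeriv F 0 v v :=
  exists_pos_coercive _ hF.posDef

/-- The stationary solution is of class `C³` near `0`. -/
lemma contDiffAt_zero (hF : IsKickPotential F) (hψ : IsStationarySolution F ψ) :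
    ContDiffAt ℝ 3 ψ 0 := by
  obtain ⟨β, hβ0, hβ⟩ := hF.exists_coercive
  have hF2 : ContDiffAt ℝ 2 F 0 := hF.contDiff.contDiffAt.of_le (by norm_num)
  obtain ⟨Z, hZ, ρ, hρ, hZρ⟩ := exists_contDiffAt_first_entry hF.contDiff_gradient
    hF.gradient_zero hβ0 (fun v => by rw [inner_fderiv_gradient hF2]; exact hβ v)
  obtain ⟨r', hr', hconv⟩ := exists_ball_strongly_convex hF2 hβ0 hβ
  obtain ⟨r, hr, rfl⟩ : ∃ r, 0 < r ∧ r' = 2 * r := ⟨r' / 2, by linarith, by ring⟩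
  have hFc : ∀ x, ‖x‖ < 2 * r → β / 4 * ‖x‖ ^ 2 ≤ F x := fun x hx => by
    have := hconv 0 (Metric.mem_ball_self (by linarith)) x (by simpa using hx)
    simpa [hF.map_zero, hF.fderiv_zero] using this
  obtain ⟨Y, hY⟩ := hψ.exists_selection
  have hψ0 : Tendsto ψ (𝓝 0) (𝓝 0) := by
    have := hψ.continuous.tendsto 0
    rwa [hψ.map_zero] at this
  have hn0 : Tendsto (fun x : E d => ‖x‖) (𝓝 0) (𝓝 0) := by
    simpa using (continuous_norm (E := E d)).tendsto 0
  -- For `x` near `0` a backward chain is so small in `ℓ²` that it is the solution found by the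
  -- inverse function theorem; hence `Z x` is its first point, a minimizer.
  refine contDiffAt_of_selection hψ ?_ hZ
  filter_upwards [hψ0.eventually (gt_mem_nhds (show 0 < β / 4 * r ^ 2 by positivity)),
    hψ0.eventually (gt_mem_nhds (show 0 < r ^ 2 / 2 by positivity)),
    hψ0.eventually (gt_mem_nhds (show 0 < β / 4 * ρ ^ 2 by positivity)),
    hn0.eventually (gt_mem_nhds hr)] with x h1 h2 h3 h4
  have hu := iterate_mem_argminPsi hY x
  have hc : 0 < β / 4 := by positivity
  obtain ⟨X, hX, hXu⟩ := exists_chain_sqSeq hF hψ (u := fun k => Y^[k] x) hu hc hFc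
    (norm_chain_lt hF hψ hu hr hc hFc h4 h1 h2) hr hρ h3
  have h5 := hZρ X hX fun k => by
    rw [hXu, hXu, hXu]
    exact euler_lagrange hF hψ (hu (k + 1)) (hu (k + 2))
  have h6 : gradient F (X 0) + (2 : ℝ) • X 0 - X 1 = x := by
    rw [hXu, hXu, ← sub_eq_zero]
    exact euler_lagrange hF hψ (hu 0) (hu 1)
  rw [h6, hXu] at h5
  rw [h5]
  exact hu 0

/-- Regularity of `ψ` propagates forward along minimizing chains. -/
lemma contDiffAt_of_argminPsi (hF : IsKickPotential F) (hψ : IsStationarySolution F ψ) {x y z : E d}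
    (hx : x ∈ argminPsi F ψ z) (hy : y ∈ argminPsi F ψ x) (hr : ContDiffAt ℝ 3 ψ y) :
    ContDiffAt ℝ 3 ψ x := by
  obtain ⟨c, hc, hgrowth⟩ := exists_quadratic_growth_of_mem_argminPsi hF hψ
  obtain ⟨Y, hY⟩ := hψ.exists_selection
  have hYx : Y x = y := by
    have h1 := hgrowth x y z hx hy (Y x)
    rw [hψ.mem_argminPsi_iff.1 (hY x), sub_self] at h1
    have h2 : ‖Y x - y‖ ^ 2 = 0 := le_antisymm (nonpos_of_mul_nonpos_right h1 hc) (sq_nonneg _)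
    exact sub_eq_zero.1 (norm_eq_zero.1 (pow_eq_zero_iff two_ne_zero |>.1 h2))
  subst hYx
  have hcont := continuousAt_selection hF hψ hY hc (hgrowth x _ z hx hy)
  let f : E d → ℝ := fun w => ψ w + F w + ‖w - x‖ ^ 2 / 2
  have hf_eq : ∀ w, f w = genFunPsi F ψ w x := fun w => by
    simp only [f, genFunPsi, genFun, norm_sub_rev x w]; ring
  have hf : ContDiffAt ℝ 3 f (Y x) :=
    (hr.add hF.contDiff.contDiffAt).add
      (((contDiff_id.sub contDiff_const).norm_sq ℝ).div_const 2).contDiffAt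
  have hgrad : ∀ w, DifferentiableAt ℝ ψ w →
      gradient f w = gradient ψ w + gradient F w + (w - x) := fun w hw =>
    ((hw.hasGradientAt.fun_add (hF.differentiable w).hasGradientAt).fun_add
      (hasGradientAt_half_norm_sub_sq x w)).gradient
  have hd : ∀ᶠ w in 𝓝 (Y x), DifferentiableAt ℝ ψ w :=
    (hr.eventually (by simp)).mono fun w hw => hw.differentiableAt (by norm_num)
  have hf2 : ContDiffAt ℝ 2 f (Y x) := hf.of_le (by norm_num)
  have hf0 : fderiv ℝ f (Y x) = 0 :=
    IsLocalMin.fderiv_eq_zero (Eventually.of_forall fun w => by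
      simp only [hf_eq]; exact hY x w)
  -- Quadratic growth of `f` around its minimum passes to the second derivative through the Taylor
  -- limit.
  have hcoer : IsCoercive (secondDeriv f (Y x)) := by
    refine ⟨2 * c, by positivity, fun v => ?_⟩
    have hlim := tendsto_second_order hf2 v
    have : c * ‖v‖ ^ 2 ≤ secondDeriv f (Y x) v v / 2 := by
      refine ge_of_tendsto hlim ?_
      filter_upwards [self_mem_nhdsWithin] with t ht
      have ht : t ≠ 0 := ht
      have h1 := hgrowth x _ z hx hy (Y x + t • v)
      rw [← hψ.mem_argminPsi_iff.1 (hY x), ← hf_eq, ← hf_eq, add_sub_cancel_left, norm_smul,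
        Real.norm_eq_abs, mul_pow, sq_abs] at h1
      rw [le_div_iff₀ (by positivity), hf0]
      simp only [zero_apply, mul_zero, sub_zero]
      linarith
    nlinarith
  have hT : ContDiffAt ℝ 2 (gradient f) (Y x) := contDiffAt_gradient hf (by norm_num)
  have h2 : (2 : WithTop ℕ∞) ≠ 0 := by norm_num
  have hT' : HasFDerivAt (gradient f)
      (hcoer.continuousLinearEquivOfBilin : E d →L[ℝ] E d) (Y x) := by
    have h3 := (hT.differentiableAt h2).hasFDerivAt
    convert! h3 using 1
    ext1 v
    exact (hcoer.unique_continuousLinearEquivOfBilin fun w => inner_fderiv_gradient hf2 v w).symm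
  have hS := hT.to_localInverse hT' h2
  have hleft := (hT.hasStrictFDerivAt' hT' h2).eventually_left_inverse
  have hT0 : gradient f (Y x) = 0 := by
    rw [hgrad _ hd.self_of_nhds]
    exact gradient_at_argminPsi hF (hY x) hd.self_of_nhds
  rw [hT0] at hS
  -- The optimality condition for `Y w` reads `∇f (Y w) = w - x`; as `Y` is continuous at `x`, it
  -- agrees near `x` with the local inverse of `∇f`.
  refine contDiffAt_of_selection hψ (Y := fun w => hT.localInverse hT' h2 (w - x)) ?_ ?_
  · filter_upwards [hcont.eventually hd, hcont.eventually hleft] with w hw1 hw2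
    have h4 := gradient_at_argminPsi hF (hY w) hw1
    have h5 : gradient f (Y w) = w - x := by
      rw [hgrad _ hw1, ← sub_eq_zero, ← h4]; abel
    rw [h5] at hw2
    have h6 : hT.localInverse hT' h2 (w - x) = Y w := hw2
    rw [h6]
    exact hY w
  · refine ContDiffAt.comp x ?_ (contDiffAt_id.sub contDiffAt_const)
    change ContDiffAt ℝ 2 (hT.localInverse hT' h2) (x - x)
    rwa [sub_self]

lemma isOpen_setOf_contDiffAt (f : E d → ℝ) : IsOpen {x | ContDiffAt ℝ 3 f x} :=
  isOpen_iff_mem_nhds.2 fun _ hx => ContDiffAt.eventually hx (by simp)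

/-- The stationary solution is `C³` near every minimizer. -/
theorem contDiffAt_of_mem_argminPsi (hF : IsKickPotential F) (hψ : IsStationarySolution F ψ)
    {x z : E d} (hx : x ∈ argminPsi F ψ z) : ContDiffAt ℝ 3 ψ x := by
  obtain ⟨Y, hY⟩ := hψ.exists_selection
  -- The singular set is closed, periodic and free of zeros of `F`. A chain staying in it would cost
  -- at least `η` per step, against a total of at most `ψ x`.
  obtain ⟨η, hη, hηF⟩ := hF.periodic.exists_pos_le hF.contDiff.continuous
    (isOpen_setOf_contDiffAt ψ).isClosed_compl
    (fun k y hy h => by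
      change ContDiffAt ℝ 3 ψ (y + latticeVec k) at h
      exact hy (hψ.periodic.contDiffAt_of_add_latticeVec h)) (fun y hy => by
      refine (hF.nonneg y).lt_of_ne fun h => hy ?_
      obtain ⟨k, rfl⟩ := hF.mem_range_of_eq_zero h.symm
      change ContDiffAt ℝ 3 ψ (latticeVec k)
      refine hψ.periodic.contDiffAt_of_add_latticeVec (k := -k) ?_
      rw [latticeVec_neg, add_neg_cancel]
      exact contDiffAt_zero hF hψ)
  have hu := iterate_mem_argminPsi hY x
  obtain ⟨k, hk⟩ : ∃ k, ContDiffAt ℝ 3 ψ (Y^[k + 1] x) := by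
    by_contra! hcon
    obtain ⟨n, hn⟩ := exists_nat_gt (ψ x / η)
    rw [div_lt_iff₀ hη] at hn
    have h1 := sum_potential_le_of_chain hF hψ hu n
    have h2 : ∑ _k ∈ Finset.range n, η ≤ ∑ k ∈ Finset.range n, F (Y^[k + 1] x) :=
      Finset.sum_le_sum fun k _ => hηF _ (hcon k)
    simp only [Finset.sum_const, Finset.card_range, nsmul_eq_mul] at h2
    simp only [Function.iterate_zero, id] at h1
    linarith
  have key : ∀ k, ContDiffAt ℝ 3 ψ (Y^[k] x) → ContDiffAt ℝ 3 ψ x := by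
    intro k
    induction k with
    | zero => exact id
    | succ k ih =>
      intro h
      refine ih ?_
      cases k with
      -- The propagation step needs `x` to be a minimizer itself; at the start of the chain `z`
      -- supplies this.
      | zero => exact contDiffAt_of_argminPsi hF hψ hx (hu 0) h
      | succ k => exact contDiffAt_of_argminPsi hF hψ (hu k) (hu (k + 1)) h
  exact key _ hk

end Regularity

/-! ### Existence of admissible neighbourhoods -/

section Existence

variable {d : ℕ} {F ψ : E d → ℝ}

lemma norm_sub_argminPsi_le (hF : IsKickPotential F) (hψ : IsStationarySolution F ψ) {S : ℝ}
    (hS : ∀ x, ψ x ≤ S) {x y : E d} (hy : y ∈ argminPsi F ψ x) : ‖x - y‖ ≤ 2 * S + 1 := by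
  have h1 := hS x
  have h2 := hψ.nonneg hF y
  have h3 := hF.nonneg y
  have h4 := hψ.nonneg hF x
  rw [hψ.mem_argminPsi_iff, genFunPsi, genFun] at hy
  nlinarith [norm_nonneg (x - y)]

lemma mem_argminPsi_of_genFunPsi_le (hψ : IsStationarySolution F ψ) {x y : E d}
    (h : genFunPsi F ψ y x ≤ ψ x) : y ∈ argminPsi F ψ x :=
  hψ.mem_argminPsi_iff.2 (le_antisymm h (hψ.le_genFunPsi y x))

lemma continuous_genFunPsi (hF : IsKickPotential F) (hψ : IsStationarySolution F ψ) :
    Continuous fun z : E d × E d => genFunPsi F ψ z.2 z.1 := by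
  have h1 := hF.contDiff.continuous
  have h2 := hψ.continuous
  unfold genFunPsi genFun
  fun_prop

/-- The properties required of a neighbourhood in the set `U` of regular points. -/
structure IsRegularNhd (F ψ : E d → ℝ) (W : Set (E d)) (K δ : ℝ) : Prop where
  isOpen : IsOpen W
  contDiffAt : ∀ x ∈ W, ContDiffAt ℝ 3 ψ x
  bounded : ∀ x ∈ W, ‖secondDeriv ψ x‖ ≤ K
  growth : ∀ x ∈ W, ∀ y ∈ argminPsi F ψ x, ∀ y',
    δ * ‖y' - y‖ ^ 2 ≤ genFunPsi F ψ y' x - ψ x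

/-- `quadratic_growth` needs a paraboloid below `ψ` on the whole space. For `‖w‖ < r` it comes from
Taylor's formula; for `‖w‖ ≥ r` the bounds `0 ≤ ψ ≤ S` and `‖x - y‖ ≤ 2 * S + 1` suffice, which
explains the extra terms in `K'`. -/
lemma exists_isRegularNhd_of_contDiffAt (hF : IsKickPotential F) (hψ : IsStationarySolution F ψ)
    {x₀ : E d} (h₀ : ContDiffAt ℝ 3 ψ x₀) :
    ∃ W K δ, x₀ ∈ W ∧ 0 < δ ∧ IsRegularNhd F ψ W K δ := by
  obtain ⟨S, hS⟩ := hψ.periodic.exists_le hψ.continuous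
  have hS0 : 0 ≤ S := (hψ.nonneg hF 0).trans (hS 0)
  set K := ‖secondDeriv ψ x₀‖ + 1 with hKdef
  have hK0 : 0 ≤ K := by positivity
  have hcont : ContinuousAt (fun x => ‖secondDeriv ψ x‖) x₀ := by
    have h1 : ContDiffAt ℝ 1 (fderiv ℝ (fderiv ℝ ψ)) x₀ :=
      (h₀.fderiv_right (m := 2) (by norm_num)).fderiv_right (by norm_num)
    exact (continuous_norm (E := E d →L[ℝ] E d →L[ℝ] ℝ)).continuousAt.comp h1.continuousAt
  have hK : ∀ᶠ x in 𝓝 x₀, ‖secondDeriv ψ x‖ < K :=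
    hcont.eventually (gt_mem_nhds (by linarith))
  obtain ⟨r', hr', hball⟩ := Metric.eventually_nhds_iff_ball.1 (hK.and (h₀.eventually (by simp)))
  obtain ⟨r, hr, rfl⟩ : ∃ r, 0 < r ∧ r' = 2 * r := ⟨r' / 2, by linarith, by ring⟩
  have hsub : Metric.ball x₀ r ⊆ Metric.ball x₀ (2 * r) := Metric.ball_subset_ball (by linarith)
  set K' := K + (S / r ^ 2 + (2 * S + 1) / r) with hK'
  have hK'0 : 0 ≤ K' := by positivity
  refine ⟨Metric.ball x₀ r, K, 1 / (2 * (2 * K' + 1)), Metric.mem_ball_self hr, by positivity,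
    Metric.isOpen_ball, fun x hx => (hball x (hsub hx)).2, fun x hx => (hball x (hsub hx)).1.le,
    fun x hx y hy y' => ?_⟩
  refine quadratic_growth hψ hK'0 (fun w => ?_) y'
  have hxd := (hball x (hsub hx)).2.differentiableAt (by norm_num)
  have hw0 := norm_nonneg w
  obtain hw | hw := lt_or_ge ‖w‖ r
  · have hxw : x + w ∈ Metric.ball x₀ (2 * r) := by
      rw [mem_ball_iff_norm] at hx ⊢
      have := norm_add_le (x - x₀) w
      rw [show x + w - x₀ = x - x₀ + w by abel]
      linarith
    have := abs_sub_sub_fderiv_le (convex_ball x₀ (2 * r)) hK0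
      (fun z hz => (hball z hz).2.of_le (by norm_num)) (fun z hz => (hball z hz).1.le) (hsub hx) hxw
    rw [add_sub_cancel_left, ← inner_gradient, gradient_eq_sub hψ hy hxd] at this
    have h1 := (abs_le.1 this).1
    have h2 : 0 ≤ (S / r ^ 2 + (2 * S + 1) / r) * ‖w‖ ^ 2 := by positivity
    rw [hK']
    linarith
  · have h1 := real_inner_le_norm (x - y) w
    have h2 := mul_le_mul_of_nonneg_right (norm_sub_argminPsi_le hF hψ hS hy) hw0
    have h3 := hψ.nonneg hF (x + w)
    have h4 : ψ x ≤ S / r ^ 2 * ‖w‖ ^ 2 := by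
      refine (hS x).trans ?_
      rw [div_mul_eq_mul_div, le_div_iff₀ (by positivity)]
      gcongr
    have h5 : (2 * S + 1) * ‖w‖ ≤ (2 * S + 1) / r * ‖w‖ ^ 2 := by
      rw [div_mul_eq_mul_div, le_div_iff₀ hr, mul_assoc]
      refine mul_le_mul_of_nonneg_left ?_ (by positivity)
      nlinarith
    have h6 : 0 ≤ K * ‖w‖ ^ 2 := by positivity
    rw [hK']
    linarith

lemma IsRegularNhd.mono_const {W : Set (E d)} {K K' δ δ' : ℝ} (h : IsRegularNhd F ψ W K δ)
    (hK : K ≤ K') (hδ : δ' ≤ δ) : IsRegularNhd F ψ W K' δ' where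
  isOpen := h.isOpen
  contDiffAt := h.contDiffAt
  bounded := fun x hx => (h.bounded x hx).trans hK
  growth := fun x hx y hy y' =>
    (mul_le_mul_of_nonneg_right hδ (sq_nonneg _)).trans (h.growth x hx y hy y')

lemma IsRegularNhd.union {W W' : Set (E d)} {K δ : ℝ} (h : IsRegularNhd F ψ W K δ)
    (h' : IsRegularNhd F ψ W' K δ) : IsRegularNhd F ψ (W ∪ W') K δ where
  isOpen := h.isOpen.union h'.isOpen
  contDiffAt := fun x hx => hx.elim (h.contDiffAt x) (h'.contDiffAt x)
  bounded := fun x hx => hx.elim (h.bounded x) (h'.bounded x)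
  growth := fun x hx => hx.elim (h.growth x) (h'.growth x)

lemma exists_isRegularNhd_of_isCompact (hF : IsKickPotential F) (hψ : IsStationarySolution F ψ)
    {A : Set (E d)} (hA : IsCompact A) (hreg : ∀ x ∈ A, ContDiffAt ℝ 3 ψ x) :
    ∃ W K δ, A ⊆ W ∧ 0 < δ ∧ IsRegularNhd F ψ W K δ := by
  refine hA.induction_on (p := fun A => ∃ W K δ, A ⊆ W ∧ 0 < δ ∧ IsRegularNhd F ψ W K δ)
    ?_ ?_ ?_ ?_
  · exact ⟨∅, 0, 1, subset_rfl, one_pos, isOpen_empty, by simp, by simp, by simp⟩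
  · rintro s t hst ⟨W, K, δ, hW, h⟩
    exact ⟨W, K, δ, hst.trans hW, h⟩
  · rintro s t ⟨W, K, δ, hW, hδ, h⟩ ⟨W', K', δ', hW', hδ', h'⟩
    exact ⟨W ∪ W', max K K', min δ δ', union_subset_union hW hW', lt_min hδ hδ',
      (h.mono_const (le_max_left _ _) (min_le_left _ _)).union
        (h'.mono_const (le_max_right _ _) (min_le_right _ _))⟩
  · intro x hx
    obtain ⟨W, K, δ, hxW, hδ, h⟩ := exists_isRegularNhd_of_contDiffAt hF hψ (hreg x hx)
    exact ⟨W, mem_nhdsWithin_of_mem_nhds (h.isOpen.mem_nhds hxW), W, K, δ, subset_rfl, hδ, h⟩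

/-- A periodic neighbourhood of all minimizers consisting of regular points. -/
lemma exists_periodic_isRegularNhd (hF : IsKickPotential F) (hψ : IsStationarySolution F ψ) :
    ∃ U K δ, 0 < δ ∧ IsRegularNhd F ψ U K δ ∧ (∀ x y, y ∈ argminPsi F ψ x → y ∈ U) ∧
      ∀ k, ∀ x, x + latticeVec k ∈ U → x ∈ U := by
  obtain ⟨S, hS⟩ := hψ.periodic.exists_le hψ.continuous
  -- Up to translation, all minimizers. The condition `h_ψ ≤ ψ` is closed, and a minimizer lies
  -- within `2 * S + 1` of its base point, so `A` is compact.
  let A : Set (E d) := Prod.snd '' ((Metric.closedBall (0 : E d) (√d + (2 * S + 1)) ×ˢ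
    Metric.closedBall (0 : E d) (√d)) ∩ {z | genFunPsi F ψ z.2 z.1 ≤ ψ z.1})
  have hA : IsCompact A := by
    refine IsCompact.image ?_ continuous_snd
    refine ((isCompact_closedBall _ _).prod (isCompact_closedBall _ _)).inter_right ?_
    exact isClosed_le (continuous_genFunPsi hF hψ) (hψ.continuous.comp continuous_fst)
  obtain ⟨W, K, δ, hAW, hδ, hW⟩ := exists_isRegularNhd_of_isCompact hF hψ hA (by
    rintro _ ⟨z, ⟨-, hz⟩, rfl⟩
    exact contDiffAt_of_mem_argminPsi hF hψ (mem_argminPsi_of_genFunPsi_le hψ hz))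
  refine ⟨{x | ∃ k, x + latticeVec k ∈ W}, K, δ, hδ, ⟨?_, ?_, ?_, ?_⟩, ?_, ?_⟩
  · rw [ofPred_exists]
    exact isOpen_iUnion fun k => hW.isOpen.preimage (by fun_prop)
  · rintro x ⟨k, hk⟩
    exact hψ.periodic.contDiffAt_of_add_latticeVec (hW.contDiffAt _ hk)
  · rintro x ⟨k, hk⟩
    rw [← hψ.periodic.secondDeriv_add_latticeVec k]
    exact hW.bounded _ hk
  · rintro x ⟨k, hk⟩ y hy y'
    have := hW.growth _ hk _ (add_latticeVec_mem_argminPsi hF hψ k hy) (y' + latticeVec k)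
    rwa [genFunPsi_add_latticeVec hF hψ, hψ.periodic, add_sub_add_right_eq_sub] at this
  · intro x y hy
    obtain ⟨k, hk⟩ := exists_norm_add_latticeVec_le y
    have hy' := add_latticeVec_mem_argminPsi hF hψ k hy
    refine ⟨k, hAW ⟨(x + latticeVec k, y + latticeVec k), ⟨⟨?_, by simpa using hk⟩, ?_⟩, rfl⟩⟩
    · have h1 := norm_sub_argminPsi_le hF hψ hS hy'
      have h2 := norm_le_norm_add_norm_sub' (x + latticeVec k) (y + latticeVec k)
      simp only [mem_closedBall_zero_iff]
      linarith
    · exact (hψ.mem_argminPsi_iff.1 hy').le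
  · rintro k x ⟨l, hl⟩
    refine ⟨k + l, ?_⟩
    rwa [latticeVec_add, ← add_assoc]

/-- Points outside a periodic neighbourhood of the minimizers are uniformly far from minimal. -/
lemma exists_gap (hF : IsKickPotential F) (hψ : IsStationarySolution F ψ) {U : Set (E d)}
    (hU : IsOpen U) (hsub : ∀ x y, y ∈ argminPsi F ψ x → y ∈ U)
    (hper : ∀ k, ∀ x, x + latticeVec k ∈ U → x ∈ U) :
    ∃ δ, 0 < δ ∧ ∀ x y, y ∉ U → δ ≤ genFunPsi F ψ y x - ψ x := by
  obtain ⟨S, hS⟩ := hψ.periodic.exists_le hψ.continuous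
  have hS0 : 0 ≤ S := (hψ.nonneg hF 0).trans (hS 0)
  -- For `y` beyond this radius, `‖x - y‖ ≥ 2 * S + 2`, and the kinetic term alone makes the gap at
  -- least `1`.
  let A : Set (E d × E d) := (Metric.closedBall (0 : E d) (√d) ×ˢ
    Metric.closedBall (0 : E d) (√d + (2 * S + 2))) ∩ {z | z.2 ∉ U}
  have hA : IsCompact A :=
    ((isCompact_closedBall _ _).prod (isCompact_closedBall _ _)).inter_right
      (hU.isClosed_compl.preimage continuous_snd)
  have hgap : ∃ δ, 0 < δ ∧ ∀ z ∈ A, δ ≤ genFunPsi F ψ z.2 z.1 - ψ z.1 := by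
    obtain hE | hE := A.eq_empty_or_nonempty
    · exact ⟨1, one_pos, by simp [hE]⟩
    · obtain ⟨z, hz, hmin⟩ := hA.exists_isMinOn hE
        ((continuous_genFunPsi hF hψ).sub (hψ.continuous.comp continuous_fst)).continuousOn
      refine ⟨genFunPsi F ψ z.2 z.1 - ψ z.1, ?_, fun w hw => hmin hw⟩
      by_contra! hcon
      exact hz.2 (hsub z.1 z.2 (mem_argminPsi_of_genFunPsi_le hψ (by linarith)))
  obtain ⟨δ, hδ, hgap⟩ := hgap
  refine ⟨min δ 1, by positivity, fun x y hy => ?_⟩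
  obtain ⟨k, hk⟩ := exists_norm_add_latticeVec_le x
  rw [← genFunPsi_add_latticeVec hF hψ k, ← hψ.periodic k x]
  have hy' : y + latticeVec k ∉ U := fun h => hy (hper k y h)
  set x' := x + latticeVec k
  set y' := y + latticeVec k
  obtain hyn | hyn := le_or_gt ‖y'‖ (√d + (2 * S + 2))
  · exact (min_le_left _ _).trans (hgap (x', y') ⟨⟨by simpa using hk, by simpa using hyn⟩, hy'⟩)
  · refine (min_le_right _ _).trans ?_
    have h1 := hS x'
    have h2 := hψ.nonneg hF y'
    have h3 := hF.nonneg y'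
    have h4 := norm_le_norm_add_norm_sub x' y'
    have h5 : 2 * S + 2 ≤ ‖x' - y'‖ := by linarith
    simp only [genFunPsi, genFun]
    nlinarith

/-- The first component of `Φ⁻¹(x, p)` is `x - p`. That it minimizes `h_ψ(·, x)` is a closed
condition on `(x, p)`, valid on the pseudograph by `gradient_eq_sub`, hence on its closure. -/
lemma exists_mem_argminPsi_of_mem_Dminus (hF : IsKickPotential F) (hψ : IsStationarySolution F ψ) {x : E d}
    (hx : x ∈ Dminus F ψ) : ∃ z, x ∈ argminPsi F ψ z := by
  obtain ⟨_, ⟨z, hz, rfl⟩, rfl⟩ := hx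
  have hcl : IsClosed {z : E d × E d | genFunPsi F ψ (z.1 - z.2) z.1 ≤ ψ z.1} :=
    isClosed_le ((continuous_genFunPsi hF hψ).comp
      (continuous_fst.prodMk (continuous_fst.sub continuous_snd)))
      (hψ.continuous.comp continuous_fst)
  refine ⟨z.1, mem_argminPsi_of_genFunPsi_le hψ (hcl.closure_subset_iff.2 ?_ hz)⟩
  rintro ⟨x, p⟩ ⟨hd, hp⟩
  simp only at hd hp
  subst hp
  obtain ⟨y, hy⟩ := hψ.exists_mem_argminPsi x
  simp only [mem_ofPred_eq]
  rw [gradient_eq_sub hψ hy hd, sub_sub_cancel]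
  exact (hψ.mem_argminPsi_iff.1 hy).le

theorem exists_isNondegNhd (hF : IsKickPotential F) (hψ : IsStationarySolution F ψ) :
    ∃ U, IsNondegNhd F ψ U := by
  obtain ⟨U, K, δ, hδ, hU, hsub, hper⟩ := exists_periodic_isRegularNhd hF hψ
  obtain ⟨δ', hδ', hgap⟩ := exists_gap hF hψ hU.isOpen hsub hper
  refine ⟨U, hU.isOpen, fun x hx => ?_, fun x hx => (hU.contDiffAt x hx).contDiffWithinAt,
    ⟨K, hU.bounded⟩, min δ δ', lt_min hδ hδ', fun x hx ybar hy y => ?_, fun x ybar hy y hyU => ?_⟩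
  · obtain ⟨z, hz⟩ := exists_mem_argminPsi_of_mem_Dminus hF hψ hx
    exact hsub z x hz
  · rw [hψ.mem_argminPsi_iff.1 hy]
    exact (mul_le_mul_of_nonneg_right (min_le_left _ _) (sq_nonneg _)).trans
      (hU.growth x hx ybar hy y)
  · rw [hψ.mem_argminPsi_iff.1 hy]
    exact (min_le_right _ _).trans (hgap x y hyU)

end Existence

/-! ### Discrete Gronwall estimates in `ℓ²` -/

section DiscreteGronwall

lemma sum_sq_le_of_contraction {u b : ℕ → ℝ} {l : ℝ} {n : ℕ} (hl0 : 0 ≤ l) (hl1 : l < 1)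
    (h0 : u 0 = 0) (hu : ∀ k, 0 ≤ u k) (h : ∀ k < n, u (k + 1) ≤ b k + l * u k) :
    ∑ k ∈ Finset.range n, u (k + 1) ^ 2 ≤ 1 / (1 - l) ^ 2 * ∑ k ∈ Finset.range n, b k ^ 2 := by
  have hm : 0 < 1 - l := by linarith
  -- Convexity gives `(b + l u)² ≤ b² / (1 - l) + l u²`; the boundary term `l * u n ^ 2` makes the
  -- induction close.
  have key : (1 - l) * ∑ k ∈ Finset.range n, u (k + 1) ^ 2 + l * u n ^ 2 ≤
      1 / (1 - l) * ∑ k ∈ Finset.range n, b k ^ 2 := by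
    induction n with
    | zero => simp [h0]
    | succ n ih =>
      have ih := ih fun k hk => h k (hk.trans n.lt_succ_self)
      rw [Finset.sum_range_succ, Finset.sum_range_succ, mul_add, mul_add]
      have h1 := pow_le_pow_left₀ (hu (n + 1)) (h n n.lt_succ_self) 2
      have h2 : 1 / (1 - l) * b n ^ 2 + l * u n ^ 2 - (b n + l * u n) ^ 2 =
          l / (1 - l) * (b n - (1 - l) * u n) ^ 2 := by
        field_simp; ring
      have h3 : 0 ≤ l / (1 - l) * (b n - (1 - l) * u n) ^ 2 := by positivity
      linarith
  have h2 : 0 ≤ l * u n ^ 2 := by positivity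
  have h3 : 1 / (1 - l) ^ 2 * ∑ k ∈ Finset.range n, b k ^ 2 =
      (1 / (1 - l) * ∑ k ∈ Finset.range n, b k ^ 2) / (1 - l) := by
    field_simp
  rw [h3, le_div_iff₀ hm]
  linarith

/-- A linear recursion that contracts except at boundedly many steps is bounded in `ℓ²`. -/
lemma sum_sq_le_of_few_bad_steps {a b c : ℕ → ℝ} {l L : ℝ} {n N : ℕ} {P : ℕ → Prop}
    [DecidablePred P] (hl0 : 0 < l) (hl1 : l < 1) (hL : 1 ≤ L) (h0 : a 0 = 0) (ha : ∀ k, 0 ≤ a k)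
    (hb : ∀ k, 0 ≤ b k) (h : ∀ k < n, a (k + 1) ≤ b k + c k * a k) (hcL : ∀ k < n, c k ≤ L)
    (hcl : ∀ k < n, ¬P k → c k ≤ l) (hN : ((Finset.range n).filter P).card ≤ N) :
    ∑ k ∈ Finset.range n, a (k + 1) ^ 2 ≤
      ((L / l) ^ N) ^ 2 * (1 / (1 - l) ^ 2) * ∑ k ∈ Finset.range n, b k ^ 2 := by
  have hq : 1 ≤ L / l := by rw [le_div_iff₀ hl0]; linarith
  -- The weight grows by `L / l` at each bad step, so `a k / m k` contracts by `l` at every step,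
  -- and it never exceeds `(L / l) ^ N`.
  set m : ℕ → ℝ := fun k => (L / l) ^ ((Finset.range k).filter P).card with hm
  have hm1 : ∀ k, 1 ≤ m k := fun k => one_le_pow₀ hq
  have hm0 : ∀ k, 0 < m k := fun k => one_pos.trans_le (hm1 k)
  have hmN : ∀ k ≤ n, m k ≤ (L / l) ^ N := fun k hk =>
    pow_le_pow_right₀ hq ((Finset.card_le_card (Finset.filter_subset_filter _
      (Finset.range_subset_range.2 hk))).trans hN)
  have hstep : ∀ k < n, c k * m k ≤ l * m (k + 1) := fun k hk => by
    by_cases hP : P k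
    · have : m (k + 1) = m k * (L / l) := by
        simp only [hm, Finset.range_add_one, Finset.filter_insert, if_pos hP]
        rw [Finset.card_insert_of_notMem (by simp), pow_succ]
      rw [this]
      calc c k * m k ≤ L * m k := mul_le_mul_of_nonneg_right (hcL k hk) (hm0 k).le
        _ = l * (m k * (L / l)) := by field_simp
    · have : m (k + 1) = m k := by
        simp only [hm, Finset.range_add_one, Finset.filter_insert, if_neg hP]
      rw [this]
      exact mul_le_mul_of_nonneg_right (hcl k hk hP) (hm0 k).le
  have key := sum_sq_le_of_contraction (u := fun k => a k / m k) (b := b) (n := n) hl0.le hl1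
    (by simp [h0]) (fun k => div_nonneg (ha k) (hm0 k).le) (fun k hk => by
      rw [div_le_iff₀ (hm0 _), add_mul]
      refine (h k hk).trans (add_le_add (le_mul_of_one_le_right (hb k) (hm1 _)) ?_)
      calc c k * a k = c k * m k * (a k / m k) := by field_simp [(hm0 k).ne']
        _ ≤ l * m (k + 1) * (a k / m k) :=
          mul_le_mul_of_nonneg_right (hstep k hk) (div_nonneg (ha k) (hm0 k).le)
        _ = _ := by ring)
  calc ∑ k ∈ Finset.range n, a (k + 1) ^ 2
      ≤ ∑ k ∈ Finset.range n, ((L / l) ^ N) ^ 2 * (a (k + 1) / m (k + 1)) ^ 2 := by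
        refine Finset.sum_le_sum fun k hk => ?_
        rw [← mul_pow]
        refine pow_le_pow_left₀ (ha _) ?_ 2
        calc a (k + 1) = m (k + 1) * (a (k + 1) / m (k + 1)) := by field_simp [(hm0 (k + 1)).ne']
          _ ≤ _ := mul_le_mul_of_nonneg_right (hmN _ (Finset.mem_range.1 hk))
            (div_nonneg (ha _) (hm0 _).le)
    _ = ((L / l) ^ N) ^ 2 * ∑ k ∈ Finset.range n, (a (k + 1) / m (k + 1)) ^ 2 := by
        rw [Finset.mul_sum]
    _ ≤ ((L / l) ^ N) ^ 2 * (1 / (1 - l) ^ 2 * ∑ k ∈ Finset.range n, b k ^ 2) := by gcongr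
    _ = _ := by ring

end DiscreteGronwall

/-! ### Contraction of the backward map -/

section BackwardMap

variable {d : ℕ} {F ψ : E d → ℝ}

/-- The backward map `x ↦ x - ∇ψ(x)`. -/
def backMap (ψ : E d → ℝ) (x : E d) : E d := x - gradient ψ x

lemma backMap_mem_argminPsi (hψ : IsStationarySolution F ψ) {x : E d}
    (hd : DifferentiableAt ℝ ψ x) : backMap ψ x ∈ argminPsi F ψ x := by
  obtain ⟨y, hy⟩ := hψ.exists_mem_argminPsi x
  rw [backMap, gradient_eq_sub hψ hy hd, sub_sub_cancel]
  exact hy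

lemma contDiffAt_backMap {x : E d} (h : ContDiffAt ℝ 3 ψ x) : ContDiffAt ℝ 2 (backMap ψ) x :=
  contDiffAt_id.sub (contDiffAt_gradient h (by norm_num))

lemma hasFDerivAt_backMap {x : E d} (h : ContDiffAt ℝ 3 ψ x) :
    HasFDerivAt (backMap ψ) (ContinuousLinearMap.id ℝ (E d) - fderiv ℝ (gradient ψ) x) x :=
  (hasFDerivAt_id x).sub
    ((contDiffAt_gradient (m := 2) h (by norm_num)).differentiableAt (by norm_num)).hasFDerivAt

lemma norm_fderiv_gradient_le {x : E d} (h : ContDiffAt ℝ 3 ψ x) :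
    ‖fderiv ℝ (gradient ψ) x‖ ≤ ‖secondDeriv ψ x‖ := by
  refine ContinuousLinearMap.opNorm_le_bound _ (norm_nonneg (secondDeriv ψ x)) fun v => ?_
  have h1 := inner_fderiv_gradient (h.of_le (by norm_num : (2 : WithTop ℕ∞) ≤ 3)) v
    (fderiv ℝ (gradient ψ) x v)
  rw [real_inner_self_eq_norm_sq] at h1
  set w := fderiv ℝ (gradient ψ) x v
  have h2 : ‖w‖ ^ 2 ≤ ‖secondDeriv ψ x‖ * ‖v‖ * ‖w‖ := by
    rw [h1]
    exact (le_abs_self _).trans ((secondDeriv ψ x).le_opNorm₂ v w)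
  obtain hw | hw := (norm_nonneg w).eq_or_lt
  · rw [← hw]; positivity
  · rw [pow_two] at h2
    exact le_of_mul_le_mul_right h2 hw

lemma norm_fderiv_backMap_le {x : E d} (h : ContDiffAt ℝ 3 ψ x) :
    ‖fderiv ℝ (backMap ψ) x‖ ≤ 1 + ‖secondDeriv ψ x‖ := by
  rw [(hasFDerivAt_backMap h).fderiv]
  exact (norm_sub_le _ _).trans (add_le_add ContinuousLinearMap.norm_id_le (norm_fderiv_gradient_le h))

lemma fderiv_backMap_add_latticeVec (hψ : IsStationarySolution F ψ) (k : Fin d → ℤ) (x : E d) :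
    fderiv ℝ (backMap ψ) (x + latticeVec k) = fderiv ℝ (backMap ψ) x := by
  rw [← fderiv_comp_add_right]
  have : (fun y => backMap ψ (y + latticeVec k)) = fun y => backMap ψ y + latticeVec k := by
    funext y
    simp only [backMap, hψ.periodic.gradient_add_latticeVec]
    abel
  rw [this, fderiv_add_const]

/-- The backward map contracts to first order at `0`. -/
lemma norm_fderiv_backMap_zero_lt_one (hF : IsKickPotential F) (hψ : IsStationarySolution F ψ) :
    ‖fderiv ℝ (backMap ψ) 0‖ < 1 := by
  obtain ⟨β, hβ0, hβ⟩ := hF.exists_coercive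
  have hF2 : ContDiffAt ℝ 2 F 0 := hF.contDiff.contDiffAt.of_le (by norm_num)
  have h0 := contDiffAt_zero hF hψ
  have hψ2 : ContDiffAt ℝ 2 ψ 0 := h0.of_le (by norm_num)
  have hfd : fderiv ℝ ψ 0 = 0 := IsLocalMin.fderiv_eq_zero (Eventually.of_forall fun x => by
    simpa [hψ.map_zero] using hψ.nonneg hF x)
  have hY0 : backMap ψ 0 = 0 := by
    rw [backMap, gradient, hfd, LinearIsometryEquiv.map_zero, sub_zero]
  have hd : ∀ᶠ x in 𝓝 (0 : E d), DifferentiableAt ℝ ψ x :=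
    (h0.eventually (by simp)).mono fun x hx => hx.differentiableAt (by norm_num)
  have hA : ∀ v, 0 ≤ secondDeriv ψ 0 v v := fun v => by
    have h1 : 0 ≤ secondDeriv ψ 0 v v / 2 := by
      refine ge_of_tendsto (tendsto_second_order hψ2 v) (Eventually.of_forall fun t => ?_)
      rw [hfd, hψ.map_zero]
      simp only [zero_apply, mul_zero, sub_zero]
      exact div_nonneg (hψ.nonneg hF _) (sq_nonneg t)
    linarith
  have hc : ContinuousAt (backMap ψ) 0 := (contDiffAt_backMap h0).continuousAt
  -- Differentiating this identity at its fixed point `0` gives `(D²ψ(0) + D²F(0) + 1) J = 1`;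
  -- pairing with `J v` yields `(1 + β) ‖J v‖ ≤ ‖v‖`.
  have hev : (fun x => gradient ψ (backMap ψ x) + gradient F (backMap ψ x) + backMap ψ x) =ᶠ[𝓝 0]
      id := by
    have hc' : Tendsto (backMap ψ) (𝓝 0) (𝓝 0) := by
      have := hc.tendsto
      rwa [hY0] at this
    filter_upwards [hd, hc'.eventually hd] with x h1 h2
    have := gradient_at_argminPsi hF (backMap_mem_argminPsi hψ h1) h2
    rw [id, ← sub_eq_zero, ← this]
    abel
  set J := fderiv ℝ (backMap ψ) 0
  have hJ : HasFDerivAt (backMap ψ) J 0 :=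
    ((contDiffAt_backMap h0).differentiableAt (by norm_num)).hasFDerivAt
  have hG : HasFDerivAt (gradient ψ) (fderiv ℝ (gradient ψ) 0) (backMap ψ 0) := by
    rw [hY0]
    exact ((contDiffAt_gradient (m := 2) h0 (by norm_num)).differentiableAt
      (by norm_num)).hasFDerivAt
  have hGF : HasFDerivAt (gradient F) (fderiv ℝ (gradient F) 0) (backMap ψ 0) := by
    rw [hY0]
    exact (hF.contDiff_gradient.differentiable (by norm_num) 0).hasFDerivAt
  have hsum := (((hG.comp 0 hJ).add (hGF.comp 0 hJ)).add hJ).congr_of_eventuallyEq hev.symm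
  have hid := hsum.unique (hasFDerivAt_id 0)
  have hbound : ∀ v, (1 + β) * ‖J v‖ ≤ ‖v‖ := fun v => by
    have h1 := congrArg (fun T : E d →L[ℝ] E d => inner ℝ (T v) (J v)) hid
    simp only [add_apply, ContinuousLinearMap.comp_apply, inner_add_left,
      ContinuousLinearMap.id_apply, inner_fderiv_gradient hψ2, inner_fderiv_gradient hF2,
      real_inner_self_eq_norm_sq] at h1
    have h2 := hA (J v)
    have h3 := hβ (J v)
    have h4 := real_inner_le_norm v (J v)
    obtain hw | hw := (norm_nonneg (J v)).eq_or_lt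
    · rw [← hw, mul_zero]; exact norm_nonneg v
    · refine le_of_mul_le_mul_right ?_ hw
      nlinarith
  refine (ContinuousLinearMap.opNorm_le_bound _ (by positivity : 0 ≤ 1 / (1 + β)) fun v => ?_
    ).trans_lt ((div_lt_one (by linarith)).2 (by linarith))
  rw [div_mul_eq_mul_div, one_mul, le_div_iff₀ (by linarith), mul_comm]
  exact hbound v

/-- The backward map contracts to first order where the potential is small. -/
lemma exists_contraction (hF : IsKickPotential F) (hψ : IsStationarySolution F ψ) :
    ∃ l η, 0 < l ∧ l < 1 ∧ 0 < η ∧ ∀ x, F x < η → ‖fderiv ℝ (backMap ψ) x‖ ≤ l := by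
  have h0 := norm_fderiv_backMap_zero_lt_one hF hψ
  obtain ⟨l, hl, hl1⟩ := exists_between h0
  have hl0 : 0 < l := (norm_nonneg (fderiv ℝ (backMap ψ) 0)).trans_lt hl
  -- Asking for the bound on a neighbourhood makes `G` open, so that `F` is bounded below by some `η
  -- > 0` on its closed periodic complement.
  let G : Set (E d) := {x | ∀ᶠ y in 𝓝 x, ‖fderiv ℝ (backMap ψ) y‖ ≤ l}
  have hG : IsOpen G := isOpen_setOfPred_eventually_nhds
  have hGp : ∀ k x, x + latticeVec k ∈ G → x ∈ G := fun k x hx => by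
    have hc : Tendsto (fun y => y + latticeVec k) (𝓝 x) (𝓝 (x + latticeVec k)) :=
      (continuous_id.add continuous_const).tendsto x
    have : ∀ᶠ y in 𝓝 x, ‖fderiv ℝ (backMap ψ) (y + latticeVec k)‖ ≤ l := hc.eventually hx
    simp only [fderiv_backMap_add_latticeVec hψ] at this
    exact this
  have hG0 : (0 : E d) ∈ G := by
    have hc := ((contDiffAt_backMap (contDiffAt_zero hF hψ)).fderiv_right (m := 1)
      (by norm_num)).continuousAt.norm
    exact (hc.eventually (gt_mem_nhds hl)).mono fun y hy => le_of_lt hy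
  obtain ⟨η, hη, hηF⟩ := hF.periodic.exists_pos_le hF.contDiff.continuous hG.isClosed_compl
    (fun k x hx h => hx (hGp k x h)) (fun x hx => by
      refine (hF.nonneg x).lt_of_ne fun h => hx ?_
      obtain ⟨k, rfl⟩ := hF.mem_range_of_eq_zero h.symm
      refine hGp (-k) _ ?_
      rw [latticeVec_neg, add_neg_cancel]
      exact hG0)
  refine ⟨l, η, hl0, hl1, hη, fun x hx => ?_⟩
  have : x ∈ G := by
    by_contra hcon
    exact (hηF x hcon).not_gt hx
  exact Eventually.self_of_nhds (p := fun y => ‖fderiv ℝ (backMap ψ) y‖ ≤ l) this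

end BackwardMap

/-! ### The action and its Hessian at the minimizing configuration -/

section Action

variable {d : ℕ} {F ψ : E d → ℝ} {U : Set (E d)}

lemma chain_castSucc {n : ℕ} (X : Config d n) (x : E d) (i : Fin n) :
    chain X x i.castSucc = X i := by
  simp [chain]

lemma chain_last {n : ℕ} (X : Config d n) (x : E d) : chain X x (Fin.last n) = x := by
  simp [chain]

lemma chain_add_smul {n : ℕ} (X V : Config d n) (x : E d) (t : ℝ) (j : Fin (n + 1)) :
    chain (X + t • V) x j = chain X x j + t • chain V 0 j := by
  induction j using Fin.lastCases with
  | last => simp [chain_last]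
  | cast i => simp [chain_castSucc]

lemma contDiff_chain {n : ℕ} (x : E d) (j : Fin (n + 1)) :
    ContDiff ℝ 2 fun X : Config d n => chain X x j := by
  induction j using Fin.lastCases with
  | last => simp only [chain_last]; exact contDiff_const
  | cast i =>
    simp only [chain_castSucc]
    exact (PiLp.proj (𝕜 := ℝ) 2 (fun _ : Fin n => E d) i).contDiff

/-- Telescoping: `ψ` at the intermediate points cancels. Every summand is a nonnegative gap, so the
action can be estimated link by link. -/
lemma action_eq_sum (n : ℕ) (x : E d) (X : Config d n) :
    action F ψ n x X = ∑ i : Fin n,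
      (genFunPsi F ψ (chain X x i.castSucc) (chain X x i.succ) - ψ (chain X x i.succ)) := by
  have h1 := Fin.sum_univ_succ fun j => ψ (chain X x j)
  rw [Fin.sum_univ_castSucc, chain_last] at h1
  simp only [action, genFunPsi, Finset.sum_sub_distrib, Finset.sum_add_distrib]
  linarith

lemma action_nonneg (hψ : IsStationarySolution F ψ) (n : ℕ) (x : E d) (X : Config d n) :
    0 ≤ action F ψ n x X := by
  rw [action_eq_sum]
  exact Finset.sum_nonneg fun i _ => sub_nonneg.2 (hψ.le_genFunPsi _ _)

lemma contDiff_genFun (hF : IsKickPotential F) :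
    ContDiff ℝ 2 fun z : E d × E d => genFun F z.1 z.2 :=
  (((contDiff_snd.sub contDiff_fst).norm_sq ℝ).div_const 2).add
    ((hF.contDiff.of_le (by norm_num)).comp contDiff_fst)

lemma contDiffAt_action (hF : IsKickPotential F) {n : ℕ} {x : E d} {X : Config d n}
    (h : ContDiffAt ℝ 3 ψ (chain X x 0)) : ContDiffAt ℝ 2 (action F ψ n x) X := by
  have e1 : ContDiff ℝ 2 fun X : Config d n =>
      ∑ i : Fin n, genFun F (chain X x i.castSucc) (chain X x i.succ) :=
    ContDiff.sum fun i _ => ContDiff.comp (g := fun z : E d × E d => genFun F z.1 z.2)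
      (f := fun X : Config d n => (chain X x i.castSucc, chain X x i.succ)) (contDiff_genFun hF)
      ((contDiff_chain x i.castSucc).prodMk (contDiff_chain x i.succ))
  have e2 : ContDiffAt ℝ 2 (fun X : Config d n => ψ (chain X x 0)) X :=
    ContDiffAt.comp X (g := ψ) (f := fun X : Config d n => chain X x 0)
      (h.of_le (by norm_num)) (contDiff_chain x 0).contDiffAt
  exact (e1.contDiffAt.add e2).sub contDiffAt_const

lemma IsNondegNhd.contDiffAt (hU : IsNondegNhd F ψ U) {x : E d} (hx : x ∈ U) :
    ContDiffAt ℝ 3 ψ x := hU.contDiffOn.contDiffAt (hU.isOpen.mem_nhds hx)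

lemma IsNondegNhd.differentiableAt (hU : IsNondegNhd F ψ U) {x : E d} (hx : x ∈ U) :
    DifferentiableAt ℝ ψ x := (hU.contDiffAt hx).differentiableAt (by norm_num)

/-- By the definition of `Dminus`, `backMap ψ x` belongs to it. Thus backward orbits never leave
`U`, where `ψ` is smooth. -/
lemma IsNondegNhd.backMap_mem (hU : IsNondegNhd F ψ U) {x : E d} (hx : x ∈ U) :
    backMap ψ x ∈ U :=
  hU.subset ⟨_, ⟨(x, gradient ψ x), subset_closure ⟨hU.differentiableAt hx, rfl⟩, rfl⟩, rfl⟩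

lemma IsNondegNhd.iterate_backMap_mem (hU : IsNondegNhd F ψ U) {x : E d} (hx : x ∈ U) (k : ℕ) :
    (backMap ψ)^[k] x ∈ U := by
  induction k with
  | zero => exact hx
  | succ k ih => rw [Function.iterate_succ_apply']; exact hU.backMap_mem ih

/-- The first order condition at the minimizer is exactly the momentum component of `Φ⁻¹`; hence
`Φ⁻¹` acts on the graph over `U` as `backMap ψ` on the base. -/
lemma twistMap_symm_gradient (hF : IsKickPotential F) (hψ : IsStationarySolution F ψ)
    (hU : IsNondegNhd F ψ U) {x : E d} (hx : x ∈ U) :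
    (twistMap F).symm (x, gradient ψ x) = (backMap ψ x, gradient ψ (backMap ψ x)) := by
  have h := gradient_at_argminPsi hF (backMap_mem_argminPsi hψ (hU.differentiableAt hx))
    (hU.differentiableAt (hU.backMap_mem hx))
  have h2 : gradient ψ x - gradient F (backMap ψ x) = gradient ψ (backMap ψ x) := by
    have h3 : gradient ψ x = x - backMap ψ x := by rw [backMap, sub_sub_cancel]
    rw [h3, ← sub_eq_zero, ← neg_eq_zero, ← h]
    abel
  exact Prod.ext rfl h2

lemma iterate_twistMap_symm (hF : IsKickPotential F) (hψ : IsStationarySolution F ψ)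
    (hU : IsNondegNhd F ψ U) {x : E d} (hx : x ∈ U) (k : ℕ) :
    (twistMap F).symm^[k] (x, gradient ψ x) =
      ((backMap ψ)^[k] x, gradient ψ ((backMap ψ)^[k] x)) := by
  induction k with
  | zero => rfl
  | succ k ih =>
    rw [Function.iterate_succ_apply', Function.iterate_succ_apply', ih,
      twistMap_symm_gradient hF hψ hU (hU.iterate_backMap_mem hx k)]

lemma chain_minConfig (hF : IsKickPotential F) (hψ : IsStationarySolution F ψ)
    (hU : IsNondegNhd F ψ U) {n : ℕ} {x : E d} (hx : x ∈ U) (j : Fin (n + 1)) :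
    chain (minConfig F ψ n x) x j = (backMap ψ)^[n - j] x := by
  induction j using Fin.lastCases with
  | last => simp [chain_last]
  | cast i => simp [chain_castSucc, minConfig, iterate_twistMap_symm hF hψ hU hx]

lemma iterate_castSucc_eq {n : ℕ} (f : E d → E d) (x : E d) (i : Fin n) :
    f^[n - (i.castSucc : ℕ)] x = f (f^[n - (i.succ : ℕ)] x) := by
  rw [← Function.iterate_succ_apply' f]
  congr 2
  simp only [Fin.val_castSucc, Fin.val_succ]
  omega

lemma action_minConfig (hF : IsKickPotential F) (hψ : IsStationarySolution F ψ)
    (hU : IsNondegNhd F ψ U) {n : ℕ} {x : E d} (hx : x ∈ U) :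
    action F ψ n x (minConfig F ψ n x) = 0 := by
  rw [action_eq_sum]
  refine Finset.sum_eq_zero fun i _ => sub_eq_zero.2 ?_
  rw [chain_minConfig hF hψ hU hx, chain_minConfig hF hψ hU hx, iterate_castSucc_eq]
  exact hψ.mem_argminPsi_iff.1 (backMap_mem_argminPsi hψ
    (hU.differentiableAt (hU.iterate_backMap_mem hx _)))

/-- Lower bound of the Hessian by the defect of the linearized backward recursion. -/
lemma hessianStar_ge_sum (hF : IsKickPotential F) (hψ : IsStationarySolution F ψ)
    (hU : IsNondegNhd F ψ U) {δ : ℝ} (hδ : ∀ x ∈ U, ∀ ybar ∈ argminPsi F ψ x, ∀ y : E d,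
      δ * ‖y - ybar‖ ^ 2 ≤ genFunPsi F ψ y x - genFunPsi F ψ ybar x)
    {n : ℕ} {x : E d} (hx : x ∈ U) (V : Config d n) :
    2 * δ * ∑ i : Fin n, ‖chain V 0 i.castSucc -
      fderiv ℝ (backMap ψ) ((backMap ψ)^[n - (i.succ : ℕ)] x) (chain V 0 i.succ)‖ ^ 2 ≤
      hessianStar F ψ n x V V := by
  set X := minConfig F ψ n x with hX
  have hmem : ∀ j, chain X x j ∈ U := fun j => by
    rw [hX, chain_minConfig hF hψ hU hx]; exact hU.iterate_backMap_mem hx _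
  have h2 : ContDiffAt ℝ 2 (action F ψ n x) X := contDiffAt_action hF (hU.contDiffAt (hmem 0))
  have h0 : action F ψ n x X = 0 := action_minConfig hF hψ hU hx
  have hfd : fderiv ℝ (action F ψ n x) X = 0 :=
    IsLocalMin.fderiv_eq_zero (Eventually.of_forall fun Z => by
      rw [h0]; exact action_nonneg hψ n x Z)
  have hline : ∀ j, HasDerivAt (fun t : ℝ => chain X x j + t • chain V 0 j) (chain V 0 j) 0 :=
    fun j => by simpa using ((hasDerivAt_id (0 : ℝ)).smul_const (chain V 0 j)).const_add (chain X x j)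
  -- The growth bound `hδ` is used at the perturbed points, which lie in the open set `U` for small
  -- `t`.
  have hnear : ∀ᶠ t : ℝ in 𝓝 0, ∀ j, chain X x j + t • chain V 0 j ∈ U := by
    rw [eventually_all]
    intro j
    refine (hline j).continuousAt.eventually (hU.isOpen.mem_nhds ?_)
    simpa using hmem j
  have hterm : ∀ i : Fin n, Tendsto (fun t : ℝ => ‖t⁻¹ • (chain X x i.castSucc +
      t • chain V 0 i.castSucc - backMap ψ (chain X x i.succ + t • chain V 0 i.succ))‖ ^ 2)
      (𝓝[≠] 0) (𝓝 (‖chain V 0 i.castSucc -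
        fderiv ℝ (backMap ψ) ((backMap ψ)^[n - (i.succ : ℕ)] x) (chain V 0 i.succ)‖ ^ 2)) := by
    intro i
    have e1 : HasFDerivAt (backMap ψ)
        (fderiv ℝ (backMap ψ) ((backMap ψ)^[n - (i.succ : ℕ)] x))
        (chain X x i.succ + (0 : ℝ) • chain V 0 i.succ) := by
      rw [zero_smul, add_zero, ← chain_minConfig hF hψ hU hx]
      exact ((contDiffAt_backMap (hU.contDiffAt (hmem _))).differentiableAt
        (by norm_num)).hasFDerivAt
    have e2 := ((hline i.castSucc).sub (e1.comp_hasDerivAt 0 (hline i.succ))).tendsto_slope_zero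
    refine (e2.norm.pow 2).congr fun t => ?_
    have e3 : chain X x i.castSucc = backMap ψ (chain X x i.succ) := by
      rw [hX, chain_minConfig hF hψ hU hx, chain_minConfig hF hψ hU hx, iterate_castSucc_eq]
    simp [e3]
  have hsum := (tendsto_finsetSum Finset.univ fun i _ => hterm i).const_mul δ
  -- Both sides are quotients by `t²`. The limit on the right is half the Hessian, whence the factor
  -- `2 * δ`.
  have hle := le_of_tendsto_of_tendsto hsum (tendsto_second_order h2 V) (by
    filter_upwards [hnear.filter_mono nhdsWithin_le_nhds, self_mem_nhdsWithin] with t ht ht0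
    have ht0 : t ≠ 0 := ht0
    rw [h0, hfd, zero_apply, mul_zero, sub_zero, sub_zero, le_div_iff₀ (by positivity),
      action_eq_sum, mul_assoc, Finset.sum_mul, Finset.mul_sum]
    refine Finset.sum_le_sum fun i _ => ?_
    rw [chain_add_smul, chain_add_smul]
    have hm := backMap_mem_argminPsi hψ (hU.differentiableAt (ht i.succ))
    have := hδ _ (ht i.succ) _ hm (chain X x i.castSucc + t • chain V 0 i.castSucc)
    rw [hψ.mem_argminPsi_iff.1 hm] at this
    refine le_trans (le_of_eq ?_) this
    rw [norm_smul, mul_pow, norm_inv, Real.norm_eq_abs, inv_pow, sq_abs]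
    field_simp)
  rw [hessianStar]
  linarith

/-- The entry with index `-k` of a chain; `0` beyond its length. -/
def backEntry {n : ℕ} (V : Config d n) (k : ℕ) : E d :=
  chain V 0 ⟨n - k, by omega⟩

lemma norm_sq_eq_sum_backEntry {n : ℕ} (V : Config d n) :
    ‖V‖ ^ 2 = ∑ k ∈ Finset.range n, ‖backEntry V (k + 1)‖ ^ 2 := by
  rw [PiLp.norm_sq_eq_of_L2, ← Fin.sum_univ_eq_sum_range (fun k => ‖backEntry V (k + 1)‖ ^ 2),
    ← Equiv.sum_comp Fin.revPerm]
  refine Finset.sum_congr rfl fun i _ => ?_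
  rw [← chain_castSucc V 0]
  congr 3

lemma sum_defect_eq {n : ℕ} (V : Config d n) (A : ℕ → E d →L[ℝ] E d) :
    ∑ i : Fin n, ‖chain V 0 i.castSucc - A (n - (i.succ : ℕ)) (chain V 0 i.succ)‖ ^ 2 =
      ∑ k ∈ Finset.range n, ‖backEntry V (k + 1) - A k (backEntry V k)‖ ^ 2 := by
  rw [← Fin.sum_univ_eq_sum_range (fun k => ‖backEntry V (k + 1) - A k (backEntry V k)‖ ^ 2),
    ← Equiv.sum_comp Fin.revPerm]
  refine Finset.sum_congr rfl fun i _ => ?_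
  have h1 : n - ((Fin.revPerm i).succ : ℕ) = i := by
    simp only [Fin.revPerm_apply, Fin.val_succ, Fin.val_rev]; omega
  have h2 : (Fin.revPerm i).succ = ⟨n - i, by omega⟩ := by
    ext; simp only [Fin.revPerm_apply, Fin.val_succ, Fin.val_rev]; omega
  rw [h1, h2]
  congr 3

/-- Number of steps of the backward orbit at which the potential is not small. -/
lemma exists_card_bad_steps_le (hF : IsKickPotential F) (hψ : IsStationarySolution F ψ)
    (hU : IsNondegNhd F ψ U) {η : ℝ} (hη : 0 < η) :
    ∃ N : ℕ, ∀ x ∈ U, ∀ n,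
      ((Finset.range n).filter fun k => η ≤ F ((backMap ψ)^[k] x)).card ≤ N := by
  obtain ⟨S, hS⟩ := hψ.periodic.exists_le hψ.continuous
  obtain ⟨S', hS'⟩ := hF.periodic.exists_le hF.contDiff.continuous
  obtain ⟨N, hN⟩ := exists_nat_ge ((S + S') / η)
  refine ⟨N, fun x hx n => ?_⟩
  have h1 : ∑ k ∈ Finset.range n, F ((backMap ψ)^[k] x) ≤ S + S' := by
    have h2 := sum_potential_le_of_chain hF hψ (u := fun k => (backMap ψ)^[k] x) (fun k => by
      simp only [Function.iterate_succ_apply']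
      exact backMap_mem_argminPsi hψ (hU.differentiableAt (hU.iterate_backMap_mem hx k))) n
    -- The chain estimate omits the starting point, whose potential is bounded separately by `S'`.
    have h3 := Finset.sum_range_succ' (fun k => F ((backMap ψ)^[k] x)) n
    rw [Finset.sum_range_succ] at h3
    simp only [Function.iterate_zero, id] at h2 h3
    linarith [hS x, hS' x, hF.nonneg ((backMap ψ)^[n] x)]
  have h2 : ((Finset.range n).filter fun k => η ≤ F ((backMap ψ)^[k] x)).card * η ≤ S + S' := by
    refine le_trans ?_ h1
    rw [← nsmul_eq_mul]
    refine (Finset.card_nsmul_le_sum _ (fun k => F ((backMap ψ)^[k] x)) η fun k hk =>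
      (Finset.mem_filter.1 hk).2).trans ?_
    exact Finset.sum_le_sum_of_subset_of_nonneg (Finset.filter_subset _ _) fun k _ _ => hF.nonneg _
  rw [← le_div_iff₀ hη] at h2
  exact_mod_cast h2.trans hN

/-- Uniform lower bound on the Hessian. -/
lemma exists_hessianStar_ge (hF : IsKickPotential F) (hψ : IsStationarySolution F ψ)
    (hU : IsNondegNhd F ψ U) :
    ∃ C : ℝ, 1 < C ∧ ∀ n : ℕ, ∀ x ∈ U, ∀ v : Config d n,
      C⁻¹ * ‖v‖ ^ 2 ≤ hessianStar F ψ n x v v := by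
  obtain ⟨δ, hδ0, hδ, -⟩ := hU.nondeg
  obtain ⟨K, hK⟩ := hU.bounded
  obtain ⟨l, η, hl0, hl1, hη, hcontr⟩ := exists_contraction hF hψ
  obtain ⟨N, hN⟩ := exists_card_bad_steps_le hF hψ hU hη
  set L := 1 + |K| with hL
  have hL1 : 1 ≤ L := by linarith [abs_nonneg K]
  set D := ((L / l) ^ N) ^ 2 * (1 / (1 - l) ^ 2) with hD
  have hl1' : 0 < 1 - l := by linarith
  have hD0 : 0 < D := by positivity
  -- `D` bounds `‖V‖²` by the squared defects and `2 * δ` compares these with the Hessian; the `1`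
  -- only ensures `1 < C`.
  refine ⟨D / (2 * δ) + 1, by linarith [div_pos hD0 (by positivity : 0 < 2 * δ)],
    fun n x hx V => ?_⟩
  have hess := hessianStar_ge_sum hF hψ hU hδ hx V
  rw [sum_defect_eq V fun k => fderiv ℝ (backMap ψ) ((backMap ψ)^[k] x)] at hess
  -- The recursion starts from `0` because the end point `x` is held fixed. Bad steps are those with
  -- `F ≥ η`; there `‖DY‖` is only bounded by `L`.
  have key := sum_sq_le_of_few_bad_steps (a := fun k => ‖backEntry V k‖)
    (b := fun k => ‖backEntry V (k + 1) -
      fderiv ℝ (backMap ψ) ((backMap ψ)^[k] x) (backEntry V k)‖)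
    (c := fun k => ‖fderiv ℝ (backMap ψ) ((backMap ψ)^[k] x)‖) (n := n) hl0 hl1 hL1
    (by
      change ‖chain V 0 (Fin.last n)‖ = 0
      rw [chain_last, norm_zero]) (fun k => norm_nonneg _) (fun k => norm_nonneg _)
    (fun k _ => by
      have h1 := norm_le_norm_sub_add (backEntry V (k + 1))
        (fderiv ℝ (backMap ψ) ((backMap ψ)^[k] x) (backEntry V k))
      exact h1.trans (add_le_add le_rfl (ContinuousLinearMap.le_opNorm _ _)))
    (fun k _ => by
      have hk := hU.iterate_backMap_mem hx k
      exact (norm_fderiv_backMap_le (hU.contDiffAt hk)).trans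
        (add_le_add le_rfl ((hK _ hk).trans (le_abs_self K))))
    (fun k _ hk => hcontr _ (not_le.1 hk)) (hN x hx n)
  rw [← norm_sq_eq_sum_backEntry, ← hD] at key
  set Q := ∑ k ∈ Finset.range n, ‖backEntry V (k + 1) -
      fderiv ℝ (backMap ψ) ((backMap ψ)^[k] x) (backEntry V k)‖ ^ 2
  have hQ : 0 ≤ Q := Finset.sum_nonneg fun _ _ => by positivity
  have hC : 0 < D / (2 * δ) + 1 := by positivity
  rw [inv_mul_le_iff₀ hC]
  have h1 : D * Q ≤ D / (2 * δ) * hessianStar F ψ n x V V := by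
    rw [div_mul_eq_mul_div, le_div_iff₀ (by positivity)]
    nlinarith
  have h2 : 0 ≤ hessianStar F ψ n x V V := le_trans (by positivity) hess
  linarith

end Action

end KickedHJ

end

theorem mainTheorem11 {d : ℕ} (F : KickedHJ.E d → ℝ) (hF : KickedHJ.IsKickPotential F)
    (ψ : KickedHJ.E d → ℝ) (hψ : KickedHJ.IsStationarySolution F ψ) :
    (∃ U : Set (KickedHJ.E d), KickedHJ.IsNondegNhd F ψ U) ∧
    ∀ U : Set (KickedHJ.E d), KickedHJ.IsNondegNhd F ψ U →
      ∃ C : ℝ, 1 < C ∧ ∀ n : ℕ, ∀ x ∈ U,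
        IsMinOn (KickedHJ.action F ψ n x) Set.univ (KickedHJ.minConfig F ψ n x) ∧
        ContDiffAt ℝ 2 (KickedHJ.action F ψ n x) (KickedHJ.minConfig F ψ n x) ∧
        ∀ v : KickedHJ.Config d n,
          C⁻¹ * ‖v‖ ^ 2 ≤ KickedHJ.hessianStar F ψ n x v v := by
  refine ⟨KickedHJ.exists_isNondegNhd hF hψ, fun U hU => ?_⟩
  obtain ⟨C, hC1, hC⟩ := KickedHJ.exists_hessianStar_ge hF hψ hU
  refine ⟨C, hC1, fun n x hx => ⟨fun X _ => ?_, ?_, hC n x hx⟩⟩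
  · change KickedHJ.action F ψ n x (KickedHJ.minConfig F ψ n x) ≤ KickedHJ.action F ψ n x X
    rw [KickedHJ.action_minConfig hF hψ hU hx]
    exact KickedHJ.action_nonneg hψ n x X
  · refine KickedHJ.contDiffAt_action hF (hU.contDiffAt ?_)
    rw [KickedHJ.chain_minConfig hF hψ hU hx]
    exact hU.iterate_backMap_mem hx _
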